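/- **Model.** Let $N\in\mathbb N$. A *query algorithm with copies* (CBQP algorithm) acts on a finite-dimensional quantum system started in a computational basis state. Given an input $x\in\{0,1\}^N$, it performs finitely many steps of the following kinds, each allowed to depend on earlier measurement outcomes: an arbitrary unitary; a query, i.e. the phase oracle $O_x:|i,b\rangle\mapsto(-1)^{x(i)b}|i,b\rangle$ ($0\le i<N$, $b\in\{0,1\}$) applied to a register of the system; a partial collapsing measurement in the computational basis; a copy, which appends to the system, whose current state (conditioned on all earlier outcomes) is $\rho$, a fresh unentangled copy of the state of a register $A$ (possibly the whole system), $\rho\mapsto\rho\otimes\rho_A$, where $\rho_A$ is the reduced state of $\rho$ on $A$; later steps may act jointly on everything. Finally the whole system is measured and a bit depending on the result is output. $Q$ and $P$ denote the numbers of queries and of copies (maximum over measurement outcomes). The algorithm solves $f:\{0,1\}^N\to\{0,1\}$ with error $\varepsilon$ if for every $x$ it outputs $f(x)$ with probability at least $1-\varepsilon$. **Weight schemes.** A weight scheme of $f$ consists of $X\subseteq f^{-1}(0)$, $Y\subseteq f^{-1}(1)$, a non-empty $R\subseteq X\times Y$ and real weights $w,w'$ such that for all $(x,y)\in R$ and all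 $i$ with $x(i)\ne y(i)$: $w(x,y)>0$, $w'(x,y,i)>0$, $w'(y,x,i)>0$ and $w'(x,y,i)\,w'(y,x,i)\ge w(x,y)^2$. For $x\in X$ put $wt(x)=\sum_{y:(x,y)\in R}w(x,y)$ and $v(x,i)=\sum_{y:(x,y)\in R,\;x(i)\ne y(i)}w'(x,y,i)$; for $y\in Y$ put $wt(y)=\sum_{x:(x,y)\in R}w(x,y)$ and $v(y,i)=\sum_{x:(x,y)\in R,\;x(i)\neq y(i)}w'(y,x,i)$. For $C\in\{X,Y\}$ let $v_C=\max_{z\in C,\;i}v(z,i)/wt(z)$ (with $0/0=0$), and $v_{\max}=\sqrt{v_Xv_Y}$. **Theorem.** Let $0\le\varepsilon<1/2$. All constants below depend only on $\varepsilon$. 1. There is $c>0$ such that for all $N$, all $f:\{0,1\}^N\to\{0,1\}$ and every weight scheme of $f$, one has $v_{\max}>0$, and every CBQP algorithm that solves $f$ with error $\varepsilon$ satisfies $Q\cdot2^P\ge c/v_{\max}$. 2. There is $c>0$ such that for all $N$, $f$, $X\subseteq f^{-1}(0)$, $Y\subseteq f^{-1}(1)$ and non-empty $R\subseteq X\times Y$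 the following holds. Let $m$ (resp. $m'$) be the minimum over $x\in X$ (resp. $y\in Y$) of the number of pairs of $R$ containing it, and let $l$ (resp. $l'$) be the maximum over $x\in X$ (resp. $y\in Y$) and positions $i$ of the number of pairs $(x,y)\in R$ containing it with $x(i)\ne y(i)$. Then $ll'>0$, and every CBQP algorithm that solves $f$ with error $\varepsilon$ satisfies $Q\cdot2^P\ge c\sqrt{mm'/(ll')}$. 3. Consequently, for the search problem (decide whether $x\in\{0,1\}^N$ has a position $i$ with $x(i)=1$), the known search algorithm with one query and $O(\log N)$ copies is optimal: (a) there is $c>0$ such that every CBQP algorithm solving search with error $\varepsilon$ satisfies $Q\cdot 2^P\ge c\sqrt N$; (b) there are $c>0$ and $N_0$ such that for $N\ge N_0$ every CBQP algorithm solving search with error $\varepsilon$ and at most one query uses $P\ge c\log N$ copies; (c) if $\varepsilon>0$, there is $C$ such that for every $N\ge2$ some CBQP algorithm solves search with error $\varepsilon$ using exactly one query and at most $C\log N$ copies. -/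

import Mathlib

open scoped Kronecker

namespace CBQP

/-- Inputs `x = (x(0), …, x(N-1))`, bit strings of length `N`. -/
abbrev Input (N : ℕ) : Type := Fin N → Bool

/-! ### Weight schemes -/

/-- A weight scheme of the Boolean function `f`. `w' x y i` and `w' y x i` are the two weights
attached to the pair `(x, y) ∈ R` and the position `i`. -/
structure WeightScheme {N : ℕ} (f : Input N → Bool) where
  X : Finset (Input N)
  Y : Finset (Input N)
  R : Finset (Input N × Input N)
  X_sub : ∀ x ∈ X, f x = false
  Y_sub : ∀ y ∈ Y, f y = true
  R_sub : R ⊆ X ×ˢ Y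
  w : Input N → Input N → ℝ
  w' : Input N → Input N → Fin N → ℝ
  w_pos : ∀ x y, (x, y) ∈ R → 0 < w x y
  w'_pos_left : ∀ x y i, (x, y) ∈ R → x i ≠ y i → 0 < w' x y i
  w'_pos_right : ∀ x y i, (x, y) ∈ R → x i ≠ y i → 0 < w' y x i
  w_sq_le : ∀ x y i, (x, y) ∈ R → x i ≠ y i → w x y ^ 2 ≤ w' x y i * w' y x i

namespace WeightScheme

variable {N : ℕ} {f : Input N → Bool} (S : WeightScheme f)

/-- `wt(x)` for `x ∈ X`. -/
noncomputable def wtX (x : Input N) : ℝ :=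
  ∑ p ∈ S.R with p.1 = x, S.w x p.2

/-- `wt(y)` for `y ∈ Y`. -/
noncomputable def wtY (y : Input N) : ℝ :=
  ∑ p ∈ S.R with p.2 = y, S.w p.1 y

/-- The load `v(x, i)` for `x ∈ X`. -/
noncomputable def loadX (x : Input N) (i : Fin N) : ℝ :=
  ∑ p ∈ S.R with p.1 = x ∧ x i ≠ p.2 i, S.w' x p.2 i

/-- The load `v(y, i)` for `y ∈ Y`. -/
noncomputable def loadY (y : Input N) (i : Fin N) : ℝ :=
  ∑ p ∈ S.R with p.2 = y ∧ p.1 i ≠ y i, S.w' y p.1 i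

/-- The maximum `X`-load: a maximum over a finite set. An `x` without a partner in `R`
contributes `0 / 0 = 0`. -/
noncomputable def vX : ℝ :=
  ⨆ q : S.X × Fin N, S.loadX q.1 q.2 / S.wtX q.1

/-- The maximum `Y`-load. -/
noncomputable def vY : ℝ :=
  ⨆ q : S.Y × Fin N, S.loadY q.1 q.2 / S.wtY q.1

/-- The maximum load of the scheme. -/
noncomputable def vmax : ℝ := Real.sqrt (S.vX * S.vY)

end WeightScheme

/-! ### The quantities of the unweighted adversary bound -/

/-- `m`: the least number of partners in `R` of an `x ∈ X`. -/
noncomputable def minDegX {N : ℕ} (X : Finset (Input N)) (R : Finset (Input N × Input N)) : ℕ :=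
  ⨅ x : X, (R.filter fun p => p.1 = x.1).card

/-- `m'`: the least number of partners in `R` of a `y ∈ Y`. -/
noncomputable def minDegY {N : ℕ} (Y : Finset (Input N)) (R : Finset (Input N × Input N)) : ℕ :=
  ⨅ y : Y, (R.filter fun p => p.2 = y.1).card

/-- `l`: the largest number, over `x ∈ X` and positions `i`, of partners of `x` that differ
from `x` at `i`. -/
noncomputable def maxDiffX {N : ℕ} (X : Finset (Input N)) (R : Finset (Input N × Input N)) : ℕ :=
  ⨆ q : X × Fin N, (R.filter fun p => p.1 = q.1.1 ∧ p.1 q.2 ≠ p.2 q.2).card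

/-- `l'`: the same for `y ∈ Y`. -/
noncomputable def maxDiffY {N : ℕ} (Y : Finset (Input N)) (R : Finset (Input N × Input N)) : ℕ :=
  ⨆ q : Y × Fin N, (R.filter fun p => p.2 = q.1.1 ∧ p.1 q.2 ≠ p.2 q.2).card

/-! ### Quantum query algorithms that can copy states -/

/-- Circuits with queries to an `N`-bit input, acting on a quantum system whose computational
basis is labelled by the finite type `ι`. A register of the system is a tensor factor, given by a
factorization `ι ≃ A × B` of the labels.

* `output g`: measure everything in the computational basis and output `g` of the result.
* `unitary U k`: apply `U`, continue with `k`.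
* `query e k`: apply the phase oracle to the query register `|i, b⟩` singled out by `e`.
* `measure m k`: partial collapsing measurement of `m`, a function of the basis label (for
  instance the content of a register); continue with `k n` on outcome `n`.
* `copy e k`: create a fresh, unentangled copy of the current state of the register `A`
  (of the whole system if `B` is a point), on which `k` may then act jointly with the rest. -/
inductive Circuit (N : ℕ) : (ι : Type) → [Fintype ι] → [DecidableEq ι] → Type 1
  | output {ι : Type} [Fintype ι] [DecidableEq ι] (g : ι → Bool) : Circuit N ι
  | unitary {ι : Type} [Fintype ι] [DecidableEq ι] (U : Matrix.unitaryGroup ι ℂ)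
      (k : Circuit N ι) : Circuit N ι
  | query {ι : Type} [Fintype ι] [DecidableEq ι] {W : Type} (e : ι ≃ (Fin N × Bool) × W)
      (k : Circuit N ι) : Circuit N ι
  | measure {ι : Type} [Fintype ι] [DecidableEq ι] {K : Type} [Fintype K] [DecidableEq K]
      (m : ι → K) (k : K → Circuit N ι) : Circuit N ι
  | copy {ι : Type} [Fintype ι] [DecidableEq ι] {A B : Type} [Fintype A] [DecidableEq A]
      [Fintype B] (e : ι ≃ A × B) (k : Circuit N (ι × A)) : Circuit N ι

/-- The phase oracle `|i, b⟩ ↦ (-1)^(x(i)·b) |i, b⟩` on the register singled out by `e`. -/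
def phaseOracle {N : ℕ} {ι W : Type} [DecidableEq ι] (x : Input N)
    (e : ι ≃ (Fin N × Bool) × W) : Matrix ι ι ℂ :=
  Matrix.diagonal fun j => if x (e j).1.1 = true ∧ (e j).1.2 = true then -1 else 1

/-- The projector onto the span of the basis states `j` with `m j = n`. -/
def proj {ι K : Type} [DecidableEq ι] [DecidableEq K] (m : ι → K) (n : K) : Matrix ι ι ℂ :=
  Matrix.diagonal fun j => if m j = n then 1 else 0

/-- The probability of outcome `n` when `m` is measured in the state `ρ`. -/
noncomputable def outcomeProb {ι K : Type} [Fintype ι] [DecidableEq ι] [DecidableEq K]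
    (m : ι → K) (n : K) (ρ : Matrix ι ι ℂ) : ℝ :=
  (proj m n * ρ).trace.re

/-- The state after outcome `n` (normalized; the value is irrelevant if the outcome has
probability zero). -/
noncomputable def collapse {ι K : Type} [Fintype ι] [DecidableEq ι] [DecidableEq K]
    (m : ι → K) (n : K) (ρ : Matrix ι ι ℂ) : Matrix ι ι ℂ :=
  ((outcomeProb m n ρ)⁻¹ : ℂ) • (proj m n * ρ * proj m n)

/-- The reduced state of the register `A`: the partial trace over `B`. -/
def reduced {ι A B : Type} [Fintype B] (e : ι ≃ A × B) (ρ : Matrix ι ι ℂ) : Matrix A A ℂ :=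
  fun a a' => ∑ b, ρ (e.symm (a, b)) (e.symm (a', b))

namespace Circuit

/-- The probability that the circuit, run on input `x` from the density matrix `ρ`, outputs
`b`. Copying acts on the state conditioned on all earlier measurement outcomes. -/
noncomputable def outProb {N : ℕ} (x : Input N) (b : Bool) :
    {ι : Type} → [Fintype ι] → [DecidableEq ι] → Circuit N ι → Matrix ι ι ℂ → ℝ
  | _, _, _, @Circuit.output _ _ _ _ g, ρ => outcomeProb g b ρ
  | _, _, _, @Circuit.unitary _ _ _ _ U k, ρ => outProb x b k (U.1 * ρ * U.1.conjTranspose)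
  | _, _, _, @Circuit.query _ _ _ _ _ e k, ρ =>
      outProb x b k (phaseOracle x e * ρ * (phaseOracle x e).conjTranspose)
  | _, _, _, @Circuit.measure _ _ _ _ _ _ _ m k, ρ =>
      ∑ n, outcomeProb m n ρ * outProb x b (k n) (collapse m n ρ)
  | _, _, _, @Circuit.copy _ _ _ _ _ _ _ _ _ e k, ρ => outProb x b k (ρ ⊗ₖ reduced e ρ)

/-- The number of queries, in the worst case over measurement outcomes. -/
def queries {N : ℕ} : {ι : Type} → [Fintype ι] → [DecidableEq ι] → Circuit N ι → ℕ
  | _, _, _, @Circuit.output _ _ _ _ _ => 0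
  | _, _, _, @Circuit.unitary _ _ _ _ _ k => k.queries
  | _, _, _, @Circuit.query _ _ _ _ _ _ k => k.queries + 1
  | _, _, _, @Circuit.measure _ _ _ _ _ _ _ _ k => Finset.univ.sup fun n => (k n).queries
  | _, _, _, @Circuit.copy _ _ _ _ _ _ _ _ _ _ k => k.queries

/-- The number of copies, in the worst case over measurement outcomes. -/
def copies {N : ℕ} : {ι : Type} → [Fintype ι] → [DecidableEq ι] → Circuit N ι → ℕ
  | _, _, _, @Circuit.output _ _ _ _ _ => 0
  | _, _, _, @Circuit.unitary _ _ _ _ _ k => k.copies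
  | _, _, _, @Circuit.query _ _ _ _ _ _ k => k.copies
  | _, _, _, @Circuit.measure _ _ _ _ _ _ _ _ k => Finset.univ.sup fun n => (k n).copies
  | _, _, _, @Circuit.copy _ _ _ _ _ _ _ _ _ _ k => k.copies + 1

end Circuit

/-- A query algorithm with copies: a finite-dimensional system, an initial basis state and a
circuit. -/
structure Algorithm (N : ℕ) where
  ι : Type
  [fintype : Fintype ι]
  [decEq : DecidableEq ι]
  start : ι
  circuit : Circuit N ι

namespace Algorithm

attribute [instance] Algorithm.fintype Algorithm.decEq

variable {N : ℕ} (A : Algorithm N)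

/-- The probability that the algorithm outputs `b` on input `x`. -/
noncomputable def outProb (x : Input N) (b : Bool) : ℝ :=
  A.circuit.outProb x b (Matrix.single A.start A.start 1)

def queries : ℕ := A.circuit.queries

def copies : ℕ := A.circuit.copies

/-- The algorithm computes `f` with error probability at most `ε` on every input. -/
def Solves (f : Input N → Bool) (ε : ℝ) : Prop :=
  ∀ x, 1 - ε ≤ A.outProb x (f x)

end Algorithm

/-- The search problem: is some position of `x` marked? -/
def search (N : ℕ) (x : Input N) : Bool := decide (∃ i, x i = true)

end CBQP

/-! This is the adversary method, with copies treated as squaring of inner products. For each input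
`z` the state is kept as a purification `M z`, and progress is measured by the weighted `deficit`,
the sum over `R` of `w(x,y) a(x) a(y) (1 - |⟨M x, M y⟩|)`, where `a(z)²` is the probability that
input `z` reaches the current branch. Unitaries preserve the deficit. A query adds at most the load
term `queryBound`. A copy squares every inner product, and `1 - t² ≤ 2(1 - t)`, so the deficit at
most doubles.

Since copying acts on the state conditioned on earlier outcomes, measurements cannot be deferred to
the end. They are handled by splitting the deficit: what a measurement reveals through its outcome
distribution, plus the deficits of the branches with `a` rescaled, is at most the old deficit.
Correspondingly the goal is the Bhattacharyya coefficient of the output distributions, which by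
Cauchy–Schwarz is at least the weighted sum of those of the branches. Induction on the circuit gives
`affinity_loss_le`: the total loss of affinity is at most `2^P` times the initial deficit plus `Q`
query terms. The initial deficit is zero, while solving `f` forces a constant loss on every pair
(`affinity_le_of_solves`), so `Q · 2^P` is at least a constant over `vmax`.

Unit weights give the unweighted bound, and the zero string against the one-marked strings gives
search. The matching algorithm queries a uniform superposition once and copies the whole state, so
that `k` rounds give `2^k` independent samples (`outProb_copyAll`). -/

namespace CBQP

/-! ### Purified states

A density matrix `M * Mᴴ` is represented by the vector `M` on the system `ι` and an environment
`E`. -/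

section Purification

open Matrix

set_option linter.unusedSectionVars false

variable {ι E A B K : Type} [Fintype ι] [Fintype E] [Fintype A] [Fintype B]

/-- The squared norm of a purification. -/
noncomputable def mass (M : Matrix ι E ℂ) : ℝ := ∑ p : ι × E, ‖M p.1 p.2‖ ^ 2

/-- The inner product of two purifications. -/
def overlap (M M' : Matrix ι E ℂ) : ℂ := (Mᴴ * M').trace

theorem overlap_eq_sum (M M' : Matrix ι E ℂ) :
    overlap M M' = ∑ p : ι × E, star (M p.1 p.2) * M' p.1 p.2 := by
  simp only [overlap, Matrix.trace, Matrix.diag, Matrix.mul_apply, Matrix.conjTranspose_apply]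
  rw [Finset.sum_comm, Fintype.sum_prod_type]

theorem overlap_self (M : Matrix ι E ℂ) : overlap M M = (mass M : ℂ) := by
  rw [overlap_eq_sum, mass]
  push_cast
  refine Finset.sum_congr rfl fun p _ => ?_
  rw [← Complex.conj_mul']
  rfl

theorem mass_eq_re_overlap (M : Matrix ι E ℂ) : mass M = (overlap M M).re := by
  rw [overlap_self, Complex.ofReal_re]

theorem mass_nonneg (M : Matrix ι E ℂ) : 0 ≤ mass M :=
  Finset.sum_nonneg fun _ _ => by positivity

theorem norm_overlap_le (M M' : Matrix ι E ℂ) :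
    ‖overlap M M'‖ ≤ √(mass M * mass M') := by
  rw [overlap_eq_sum, Real.sqrt_mul (mass_nonneg M)]
  refine (norm_sum_le _ _).trans ?_
  simp only [norm_mul, norm_star]
  exact Real.sum_mul_le_sqrt_mul_sqrt _ _ _

theorem norm_overlap_le_one {M M' : Matrix ι E ℂ} (h : mass M ≤ 1) (h' : mass M' ≤ 1) :
    ‖overlap M M'‖ ≤ 1 :=
  (norm_overlap_le M M').trans (Real.sqrt_le_one.mpr
    (mul_le_one₀ h (mass_nonneg M') h'))

/-- A purification regrouped as a purification of the reduced state of the register `A`. -/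
def regroup (e : ι ≃ A × B) (M : Matrix ι E ℂ) : Matrix A (B × E) ℂ :=
  fun a q => M (e.symm (a, q.1)) q.2

/-- Tracing out `B` amounts to moving it into the environment, so a fresh copy of `A` is purified
with environment `B × E`. -/
theorem reduced_purified (e : ι ≃ A × B) (M : Matrix ι E ℂ) :
    reduced e (M * Mᴴ) = regroup e M * (regroup e M)ᴴ := by
  ext a a'
  simp only [reduced, regroup, Matrix.mul_apply, Matrix.conjTranspose_apply,
    Fintype.sum_prod_type]

theorem overlap_regroup (e : ι ≃ A × B) (M M' : Matrix ι E ℂ) :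
    overlap (regroup e M) (regroup e M') = overlap M M' := by
  simp only [overlap_eq_sum, regroup, Fintype.sum_prod_type]
  rw [← e.symm.sum_comp, Fintype.sum_prod_type]

/-- The purification of a state with a fresh copy of its register `A`. -/
def copied (e : ι ≃ A × B) (M : Matrix ι E ℂ) : Matrix (ι × A) (E × (B × E)) ℂ :=
  M ⊗ₖ regroup e M

theorem copy_purified (e : ι ≃ A × B) (M : Matrix ι E ℂ) :
    (M * Mᴴ) ⊗ₖ reduced e (M * Mᴴ) = copied e M * (copied e M)ᴴ := by
  rw [copied, Matrix.conjTranspose_kronecker, ← Matrix.mul_kronecker_mul, reduced_purified]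

/-- The copy carries its own full environment, so regrouping does not change the inner product, and
the tensor product multiplies it by itself. -/
theorem overlap_copied (e : ι ≃ A × B) (M M' : Matrix ι E ℂ) :
    overlap (copied e M) (copied e M') = overlap M M' ^ 2 := by
  rw [overlap, copied, copied, Matrix.conjTranspose_kronecker, ← Matrix.mul_kronecker_mul,
    Matrix.trace_kronecker, ← overlap, ← overlap, overlap_regroup, sq]

theorem mass_copied (e : ι ≃ A × B) (M : Matrix ι E ℂ) : mass (copied e M) = mass M ^ 2 := by
  rw [mass_eq_re_overlap, overlap_copied, overlap_self, ← Complex.ofReal_pow, Complex.ofReal_re]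

theorem mass_copied_le_one (e : ι ≃ A × B) {M : Matrix ι E ℂ} (h : mass M ≤ 1) :
    mass (copied e M) ≤ 1 := by
  rw [mass_copied]
  exact pow_le_one₀ (mass_nonneg M) h

theorem conj_purified (U : Matrix ι ι ℂ) (M : Matrix ι E ℂ) :
    U * (M * Mᴴ) * Uᴴ = (U * M) * (U * M)ᴴ := by
  rw [Matrix.conjTranspose_mul]
  simp only [Matrix.mul_assoc]

/-! ### Unitaries, phase oracles and measurements on purifications. -/

variable [DecidableEq ι] [Fintype K] [DecidableEq K]

theorem overlap_mul_of_isometry (U : Matrix ι ι ℂ) (hU : Uᴴ * U = 1) (M M' : Matrix ι E ℂ) :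
    overlap (U * M) (U * M') = overlap M M' := by
  rw [overlap, Matrix.conjTranspose_mul, Matrix.mul_assoc, ← Matrix.mul_assoc Uᴴ, hU,
    Matrix.one_mul, overlap]

theorem mass_mul_of_isometry (U : Matrix ι ι ℂ) (hU : Uᴴ * U = 1) (M : Matrix ι E ℂ) :
    mass (U * M) = mass M := by
  rw [mass_eq_re_overlap, overlap_mul_of_isometry U hU, ← mass_eq_re_overlap]

theorem phaseOracle_isometry {N : ℕ} {W : Type} (x : Input N)
    (e : ι ≃ (Fin N × Bool) × W) : (phaseOracle x e)ᴴ * phaseOracle x e = 1 := by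
  rw [phaseOracle, Matrix.diagonal_conjTranspose, Matrix.diagonal_mul_diagonal,
    ← Matrix.diagonal_one]
  congr 1
  funext j
  by_cases h : x (e j).1.1 = true ∧ (e j).1.2 = true <;> simp [h]

theorem proj_conjTranspose (m : ι → K) (n : K) : (proj m n)ᴴ = proj m n := by
  rw [proj, Matrix.diagonal_conjTranspose]
  congr 1
  funext j
  by_cases h : m j = n <;> simp [h]

theorem proj_mul_self (m : ι → K) (n : K) : proj m n * proj m n = proj m n := by
  rw [proj, Matrix.diagonal_mul_diagonal]
  congr 1
  funext j
  by_cases h : m j = n <;> simp [h]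

theorem sum_proj (m : ι → K) : ∑ n, proj m n = 1 := by
  ext i j
  rw [Matrix.sum_apply]
  by_cases h : i = j
  · subst h; simp [proj]
  · simp [proj, h]

theorem overlap_proj (m : ι → K) (n : K) (M M' : Matrix ι E ℂ) :
    overlap (proj m n * M) (proj m n * M') = (Mᴴ * proj m n * M').trace := by
  rw [overlap, Matrix.conjTranspose_mul, proj_conjTranspose, Matrix.mul_assoc,
    ← Matrix.mul_assoc (proj m n), proj_mul_self, Matrix.mul_assoc]

theorem sum_overlap_proj (m : ι → K) (M M' : Matrix ι E ℂ) :
    ∑ n, overlap (proj m n * M) (proj m n * M') = overlap M M' := by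
  simp only [overlap_proj]
  rw [← Matrix.trace_sum, ← Matrix.sum_mul, ← Matrix.mul_sum, sum_proj, Matrix.mul_one, overlap]

theorem sum_mass_proj (m : ι → K) (M : Matrix ι E ℂ) :
    ∑ n, mass (proj m n * M) = mass M := by
  simp only [mass_eq_re_overlap]
  rw [← Complex.re_sum, sum_overlap_proj]

theorem outcomeProb_purified (m : ι → K) (n : K) (M : Matrix ι E ℂ) :
    outcomeProb m n (M * Mᴴ) = mass (proj m n * M) := by
  rw [outcomeProb, mass_eq_re_overlap, overlap_proj, ← Matrix.mul_assoc, Matrix.trace_mul_comm,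
    Matrix.mul_assoc]

/-- The purification of the state after outcome `n`. -/
noncomputable def collapsed (m : ι → K) (n : K) (M : Matrix ι E ℂ) : Matrix ι E ℂ :=
  (((√(mass (proj m n * M)))⁻¹ : ℝ) : ℂ) • (proj m n * M)

theorem collapse_purified (m : ι → K) (n : K) (M : Matrix ι E ℂ) :
    collapse m n (M * Mᴴ) = collapsed m n M * (collapsed m n M)ᴴ := by
  rw [collapse, outcomeProb_purified, collapsed, Matrix.conjTranspose_smul, Matrix.smul_mul,
    Matrix.mul_smul, smul_smul, Matrix.conjTranspose_mul, proj_conjTranspose]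
  simp only [Matrix.mul_assoc]
  congr 1
  rw [RCLike.star_def, Complex.conj_ofReal, ← Complex.ofReal_mul, ← mul_inv,
    Real.mul_self_sqrt (mass_nonneg _), Complex.ofReal_inv]

/-- Undoes the normalization without division. If one outcome probability vanishes, Cauchy–Schwarz
makes both sides zero. -/
theorem norm_overlap_collapsed (m : ι → K) (n : K) (M M' : Matrix ι E ℂ) :
    √(mass (proj m n * M)) * √(mass (proj m n * M')) *
      ‖overlap (collapsed m n M) (collapsed m n M')‖ =
      ‖overlap (proj m n * M) (proj m n * M')‖ := by
  have hle := norm_overlap_le (proj m n * M) (proj m n * M')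
  rw [Real.sqrt_mul (mass_nonneg _)] at hle
  have hcol : overlap (collapsed m n M) (collapsed m n M') =
      (((√(mass (proj m n * M)))⁻¹ * (√(mass (proj m n * M')))⁻¹ : ℝ) : ℂ) *
        overlap (proj m n * M) (proj m n * M') := by
    simp only [collapsed, overlap, Matrix.conjTranspose_smul, Matrix.smul_mul, Matrix.mul_smul,
      smul_smul, Matrix.trace_smul, smul_eq_mul, RCLike.star_def, Complex.conj_ofReal]
    push_cast
    ring
  rw [hcol, norm_mul, Complex.norm_real, Real.norm_of_nonneg (by positivity)]
  by_cases h : √(mass (proj m n * M)) = 0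
  · rw [h] at hle ⊢
    simp only [zero_mul] at hle ⊢
    exact le_antisymm (norm_nonneg _) hle
  by_cases h' : √(mass (proj m n * M')) = 0
  · rw [h'] at hle ⊢
    simp only [mul_zero, zero_mul] at hle ⊢
    exact le_antisymm (norm_nonneg _) hle
  field_simp

/-- An impossible outcome leaves the zero vector, since `0⁻¹ = 0`. Hence the inductions assume norm
at most one rather than equal to one. -/
theorem mass_collapsed_le_one (m : ι → K) (n : K) (M : Matrix ι E ℂ) :
    mass (collapsed m n M) ≤ 1 := by
  have h : mass (collapsed m n M) = (mass (proj m n * M))⁻¹ * mass (proj m n * M) := by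
    conv_lhs => rw [mass]
    simp only [collapsed, Matrix.smul_apply, smul_eq_mul, norm_mul, mul_pow]
    rw [← Finset.mul_sum, ← mass, Complex.norm_real, Real.norm_of_nonneg (by positivity), inv_pow,
      Real.sq_sqrt (mass_nonneg _)]
  rw [h]
  exact inv_mul_le_one

end Purification

/-! ### Output distributions -/

section Distribution

open Matrix

variable {N : ℕ}

theorem Circuit.outProb_nonneg_and_sum_le {ι : Type} [Fintype ι] [DecidableEq ι]
    (C : Circuit N ι) (x : Input N) :
    ∀ {E : Type} [Fintype E] (M : Matrix ι E ℂ), mass M ≤ 1 →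
      (∀ b, 0 ≤ C.outProb x b (M * Mᴴ)) ∧ ∑ b, C.outProb x b (M * Mᴴ) ≤ 1 := by
  induction C with
  | output g =>
    intro E _ M hM
    simp only [Circuit.outProb, outcomeProb_purified]
    exact ⟨fun b => mass_nonneg _, by rwa [sum_mass_proj]⟩
  | unitary U k ih =>
    intro E _ M hM
    simp only [Circuit.outProb, conj_purified]
    refine ih _ ?_
    rwa [mass_mul_of_isometry _ (Matrix.mem_unitaryGroup_iff'.mp U.2)]
  | query e k ih =>
    intro E _ M hM
    simp only [Circuit.outProb, conj_purified]
    refine ih _ ?_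
    rwa [mass_mul_of_isometry _ (phaseOracle_isometry x e)]
  | measure m k ih =>
    intro E _ M hM
    simp only [Circuit.outProb, outcomeProb_purified, collapse_purified]
    refine ⟨fun b => Finset.sum_nonneg fun n _ => mul_nonneg (mass_nonneg _)
      ((ih n _ (mass_collapsed_le_one m n M)).1 b), ?_⟩
    rw [Finset.sum_comm]
    refine le_trans (Finset.sum_le_sum fun n _ => ?_) ((sum_mass_proj m M).trans_le hM)
    rw [← Finset.mul_sum]
    exact mul_le_of_le_one_right (mass_nonneg _) (ih n _ (mass_collapsed_le_one m n M)).2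
  | copy e k ih =>
    intro E _ M hM
    simp only [Circuit.outProb, copy_purified]
    exact ih _ (mass_copied_le_one e hM)

/-- The Bhattacharyya coefficient of the output distributions on the inputs `x` and `y`, run from
the states `ρ` and `σ`. -/
noncomputable def Circuit.affinity {ι : Type} [Fintype ι] [DecidableEq ι] (C : Circuit N ι)
    (x y : Input N) (ρ σ : Matrix ι ι ℂ) : ℝ :=
  ∑ b, √(C.outProb x b ρ) * √(C.outProb y b σ)

/-- Subprobability distributions have Bhattacharyya coefficient at most one. -/
theorem sum_sqrt_mul_sqrt_le_one {κ : Type*} [Fintype κ] (p q : κ → ℝ) (hp : ∀ n, 0 ≤ p n)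
    (hq : ∀ n, 0 ≤ q n) (hp₁ : ∑ n, p n ≤ 1) (hq₁ : ∑ n, q n ≤ 1) :
    ∑ n, √(p n) * √(q n) ≤ 1 := by
  refine (Real.sum_sqrt_mul_sqrt_le _ hp hq).trans ?_
  exact mul_le_one₀ (Real.sqrt_le_one.mpr hp₁) (Real.sqrt_nonneg _) (Real.sqrt_le_one.mpr hq₁)

/-- The affinity after a measurement dominates the mean affinity of the branches. -/
theorem Circuit.affinity_measure_ge {ι K E : Type} [Fintype ι] [DecidableEq ι] [Fintype K]
    [DecidableEq K] [Fintype E] (m : ι → K) (k : K → Circuit N ι) (x y : Input N)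
    (M M' : Matrix ι E ℂ) :
    ∑ n, √(mass (proj m n * M)) * √(mass (proj m n * M')) *
        (k n).affinity x y (collapsed m n M * (collapsed m n M)ᴴ)
          (collapsed m n M' * (collapsed m n M')ᴴ) ≤
      (Circuit.measure m k).affinity x y (M * Mᴴ) (M' * M'ᴴ) := by
  simp only [Circuit.affinity, Circuit.outProb, outcomeProb_purified, collapse_purified,
    Finset.mul_sum]
  rw [Finset.sum_comm]
  refine Finset.sum_le_sum fun b _ => ?_
  -- Cauchy–Schwarz over the measurement outcomes `n`, for each output bit `b` separately.
  refine le_trans (le_of_eq ?_) (Real.sum_sqrt_mul_sqrt_le _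
    (fun n => mul_nonneg (mass_nonneg _) ((Circuit.outProb_nonneg_and_sum_le (k n) x _
      (mass_collapsed_le_one m n M)).1 b))
    (fun n => mul_nonneg (mass_nonneg _) ((Circuit.outProb_nonneg_and_sum_le (k n) y _
      (mass_collapsed_le_one m n M')).1 b)))
  refine Finset.sum_congr rfl fun n _ => ?_
  rw [Real.sqrt_mul (mass_nonneg _), Real.sqrt_mul (mass_nonneg _)]
  ring

end Distribution

/-! ### The progress of an algorithm -/

section Progress

open Matrix

variable {N : ℕ}

theorem norm_overlap_sub_query_le {ι W E : Type} [Fintype ι] [DecidableEq ι] [Fintype E]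
    (e : ι ≃ (Fin N × Bool) × W) (x y : Input N) (M M' : Matrix ι E ℂ) :
    ‖overlap M M' - overlap (phaseOracle x e * M) (phaseOracle y e * M')‖ ≤
      ∑ p : ι × E, if x (e p.1).1.1 ≠ y (e p.1).1.1 then
        2 * (‖M p.1 p.2‖ * ‖M' p.1 p.2‖) else 0 := by
  rw [overlap_eq_sum, overlap_eq_sum, ← Finset.sum_sub_distrib]
  refine (norm_sum_le _ _).trans (Finset.sum_le_sum fun p _ => ?_)
  simp only [phaseOracle, Matrix.diagonal_mul]
  -- Where the inputs agree the two phases cancel; elsewhere the term changes by at most twice its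
  -- modulus.
  by_cases h : x (e p.1).1.1 = y (e p.1).1.1
  · rw [if_neg (not_not.mpr h), h]
    by_cases h' : y (e p.1).1.1 = true ∧ (e p.1).1.2 = true <;> simp [h']
  · rw [if_pos h]
    refine (norm_sub_le _ _).trans (le_of_eq ?_)
    have hs : ∀ (P : Prop) [Decidable P], ‖(if P then -1 else 1 : ℂ)‖ = 1 := by
      intro P _
      by_cases hP : P <;> simp [hP]
    simp only [norm_mul, norm_star, hs]
    ring

/-- Regrouping the terms of a weighted sum over pairs by the input `κ t` they belong to. -/
theorem sum_load_le {τ θ : Type*} [Fintype θ] (T : Finset τ) (κ : τ → Input N)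
    (w : τ → ℝ) (w' : τ → Fin N → ℝ) (v : ℝ) (hv : 0 ≤ v) (hw : ∀ t ∈ T, 0 ≤ w t)
    (hload : ∀ t₀ ∈ T, ∀ i, ∑ t ∈ T with κ t = κ t₀, w' t i ≤ v * ∑ t ∈ T with κ t = κ t₀, w t)
    (g : Input N → θ → ℝ) (hg : ∀ z p, 0 ≤ g z p) (hg₁ : ∀ z, ∑ p, g z p ≤ 1)
    (idx : θ → Fin N) (a : Input N → ℝ) :
    ∑ t ∈ T, ∑ p, w' t (idx p) * (a (κ t) ^ 2 * g (κ t) p) ≤ v * ∑ t ∈ T, w t * a (κ t) ^ 2 := by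
  -- Grouping by `κ` lets the same argument serve both sides of `R`, with `κ` the first or the
  -- second projection.
  have hmaps : ∀ t ∈ T, κ t ∈ T.image κ := fun t ht => Finset.mem_image_of_mem κ ht
  rw [← Finset.sum_fiberwise_of_maps_to hmaps, ← Finset.sum_fiberwise_of_maps_to hmaps
    (fun t => w t * a (κ t) ^ 2), Finset.mul_sum]
  refine Finset.sum_le_sum fun z hz => ?_
  obtain ⟨t₀, ht₀, rfl⟩ := Finset.mem_image.mp hz
  have hleft : ∑ t ∈ T with κ t = κ t₀, ∑ p, w' t (idx p) * (a (κ t) ^ 2 * g (κ t) p) =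
      ∑ p, (∑ t ∈ T with κ t = κ t₀, w' t (idx p)) * (a (κ t₀) ^ 2 * g (κ t₀) p) := by
    rw [Finset.sum_comm]
    refine Finset.sum_congr rfl fun p _ => ?_
    rw [Finset.sum_mul]
    refine Finset.sum_congr rfl fun t ht => ?_
    rw [(Finset.mem_filter.mp ht).2]
  have hright : ∑ t ∈ T with κ t = κ t₀, w t * a (κ t) ^ 2 =
      (∑ t ∈ T with κ t = κ t₀, w t) * a (κ t₀) ^ 2 := by
    rw [Finset.sum_mul]
    refine Finset.sum_congr rfl fun t ht => ?_
    rw [(Finset.mem_filter.mp ht).2]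
  have hwt : 0 ≤ ∑ t ∈ T with κ t = κ t₀, w t :=
    Finset.sum_nonneg fun t ht => hw t (Finset.mem_filter.mp ht).1
  rw [hleft, hright]
  calc _ ≤ ∑ p, (v * ∑ t ∈ T with κ t = κ t₀, w t) * (a (κ t₀) ^ 2 * g (κ t₀) p) :=
        Finset.sum_le_sum fun p _ => mul_le_mul_of_nonneg_right (hload t₀ ht₀ _)
          (mul_nonneg (sq_nonneg _) (hg _ _))
    _ = (v * ∑ t ∈ T with κ t = κ t₀, w t) * a (κ t₀) ^ 2 * ∑ p, g (κ t₀) p := by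
        rw [← Finset.mul_sum, ← Finset.mul_sum, ← mul_assoc]
    _ ≤ (v * ∑ t ∈ T with κ t = κ t₀, w t) * a (κ t₀) ^ 2 :=
        mul_le_of_le_one_right (by positivity) (hg₁ _)
    _ = _ := by ring

/-- Weighted AM–GM. It separates the contributions of `x` and `y` to a pair, using `w² ≤ w'(x,y,i)
w'(y,x,i)`. -/
theorem two_mul_le_of_sq_le {w u v s p q : ℝ} (hs : 0 < s) (hp : 0 ≤ p) (hq : 0 ≤ q)
    (h : w ^ 2 ≤ p * q) : 2 * (w * u * v) ≤ s * (p * u ^ 2) + s⁻¹ * (q * v ^ 2) := by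
  have hw : |w| ≤ √p * √q := by
    rw [← Real.sqrt_mul hp]
    exact Real.abs_le_sqrt h
  have h1 : w * u * v ≤ √p * √q * (|u| * |v|) := by
    calc w * u * v ≤ |w * u * v| := le_abs_self _
      _ = |w| * (|u| * |v|) := by rw [abs_mul, abs_mul, mul_assoc]
      _ ≤ _ := by gcongr
  have h2 := sq_nonneg (√s * (√p * |u|) - √(s⁻¹) * (√q * |v|))
  have h3 : √s * √(s⁻¹) = 1 := by
    rw [← Real.sqrt_mul hs.le, mul_inv_cancel₀ hs.ne', Real.sqrt_one]
  have h4 : (√s * (√p * |u|) - √(s⁻¹) * (√q * |v|)) ^ 2 =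
      s * (p * u ^ 2) + s⁻¹ * (q * v ^ 2) - 2 * (√p * √q * (|u| * |v|)) := by
    have e1 := Real.sq_sqrt hs.le
    have e2 := Real.sq_sqrt (inv_pos.mpr hs).le
    have e3 := Real.sq_sqrt hp
    have e4 := Real.sq_sqrt hq
    have e5 := sq_abs u
    have e6 := sq_abs v
    calc _ = √s ^ 2 * (√p ^ 2 * |u| ^ 2) + √(s⁻¹) ^ 2 * (√q ^ 2 * |v| ^ 2) -
          2 * (√s * √(s⁻¹)) * (√p * √q * (|u| * |v|)) := by ring
      _ = _ := by rw [e1, e2, e3, e4, e5, e6, h3, mul_one]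
  linarith

/-! ### Loads of a weight scheme and the effect of one query. -/

namespace WeightScheme

variable {f : Input N → Bool} (S : WeightScheme f)

theorem sum_eq_wtX (x : Input N) : ∑ p ∈ S.R with p.1 = x, S.w p.1 p.2 = S.wtX x := by
  refine Finset.sum_congr rfl fun p hp => ?_
  rw [(Finset.mem_filter.mp hp).2]

theorem sum_eq_wtY (y : Input N) : ∑ p ∈ S.R with p.2 = y, S.w p.1 p.2 = S.wtY y := by
  refine Finset.sum_congr rfl fun p hp => ?_
  rw [(Finset.mem_filter.mp hp).2]

theorem sum_eq_loadX (x : Input N) (i : Fin N) :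
    ∑ p ∈ S.R with p.1 = x, (if p.1 i ≠ p.2 i then S.w' p.1 p.2 i else 0) = S.loadX x i := by
  rw [← Finset.sum_filter, Finset.filter_filter]
  refine Finset.sum_congr (Finset.filter_congr fun p _ => ?_) fun p hp => ?_
  · exact and_congr_right fun h => by rw [h]
  · rw [(Finset.mem_filter.mp hp).2.1]

theorem sum_eq_loadY (y : Input N) (i : Fin N) :
    ∑ p ∈ S.R with p.2 = y, (if p.1 i ≠ p.2 i then S.w' p.2 p.1 i else 0) = S.loadY y i := by
  rw [← Finset.sum_filter, Finset.filter_filter]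
  refine Finset.sum_congr (Finset.filter_congr fun p _ => ?_) fun p hp => ?_
  · exact and_congr_right fun h => by rw [h]
  · rw [(Finset.mem_filter.mp hp).2.1]

theorem wtX_pos {p : Input N × Input N} (hp : p ∈ S.R) : 0 < S.wtX p.1 := by
  refine Finset.sum_pos (fun q hq => ?_) ⟨p, Finset.mem_filter.mpr ⟨hp, rfl⟩⟩
  obtain ⟨hR, h⟩ := Finset.mem_filter.mp hq
  rw [← h]
  exact S.w_pos _ _ hR

theorem wtY_pos {p : Input N × Input N} (hp : p ∈ S.R) : 0 < S.wtY p.2 := by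
  refine Finset.sum_pos (fun q hq => ?_) ⟨p, Finset.mem_filter.mpr ⟨hp, rfl⟩⟩
  obtain ⟨hR, h⟩ := Finset.mem_filter.mp hq
  rw [← h]
  exact S.w_pos _ _ hR

theorem load_div_wtX_le {p : Input N × Input N} (hp : p ∈ S.R) (i : Fin N) :
    S.loadX p.1 i / S.wtX p.1 ≤ S.vX :=
  le_ciSup (f := fun q : S.X × Fin N => S.loadX q.1 q.2 / S.wtX q.1)
    (Set.finite_range _).bddAbove (⟨p.1, (Finset.mem_product.mp (S.R_sub hp)).1⟩, i)

theorem load_div_wtY_le {p : Input N × Input N} (hp : p ∈ S.R) (i : Fin N) :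
    S.loadY p.2 i / S.wtY p.2 ≤ S.vY :=
  le_ciSup (f := fun q : S.Y × Fin N => S.loadY q.1 q.2 / S.wtY q.1)
    (Set.finite_range _).bddAbove (⟨p.2, (Finset.mem_product.mp (S.R_sub hp)).2⟩, i)

theorem exists_ne {p : Input N × Input N} (hp : p ∈ S.R) : ∃ i, p.1 i ≠ p.2 i := by
  obtain ⟨hx, hy⟩ := Finset.mem_product.mp (S.R_sub hp)
  by_contra! h
  have := S.X_sub _ hx
  rw [funext h, S.Y_sub _ hy] at this
  exact absurd this (by decide)

theorem vX_pos (h : S.R.Nonempty) : 0 < S.vX := by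
  obtain ⟨p, hp⟩ := h
  obtain ⟨i, hi⟩ := S.exists_ne hp
  refine lt_of_lt_of_le (div_pos ?_ (S.wtX_pos hp)) (S.load_div_wtX_le hp i)
  refine Finset.sum_pos (fun q hq => ?_) ⟨p, Finset.mem_filter.mpr ⟨hp, rfl, hi⟩⟩
  obtain ⟨hR, hq, hi⟩ := Finset.mem_filter.mp hq
  rw [← hq] at hi ⊢
  exact S.w'_pos_left _ _ _ hR hi

theorem vY_pos (h : S.R.Nonempty) : 0 < S.vY := by
  obtain ⟨p, hp⟩ := h
  obtain ⟨i, hi⟩ := S.exists_ne hp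
  refine lt_of_lt_of_le (div_pos ?_ (S.wtY_pos hp)) (S.load_div_wtY_le hp i)
  refine Finset.sum_pos (fun q hq => ?_) ⟨p, Finset.mem_filter.mpr ⟨hp, rfl, hi⟩⟩
  obtain ⟨hR, hq, hi⟩ := Finset.mem_filter.mp hq
  rw [← hq] at hi ⊢
  exact S.w'_pos_right _ _ _ hR hi

theorem vmax_pos (h : S.R.Nonempty) : 0 < S.vmax :=
  Real.sqrt_pos.mpr (mul_pos (S.vX_pos h) (S.vY_pos h))

/-- The bound on the progress of one query, in a branch reached on input `z` with probability
`a z ^ 2`; the parameter `s` balances the two loads. -/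
noncomputable def queryBound (s : ℝ) (a : Input N → ℝ) : ℝ :=
  s * (S.vX * ∑ p ∈ S.R, S.w p.1 p.2 * a p.1 ^ 2) +
    s⁻¹ * (S.vY * ∑ p ∈ S.R, S.w p.1 p.2 * a p.2 ^ 2)

/-- Only positions where `x` and `y` differ contribute. AM–GM splits each contribution into an
`x`-part and a `y`-part, and `sum_load_le` sums each part over the partners of a fixed input, with
the squared amplitudes of `M z` as query weights. -/
theorem sum_norm_overlap_sub_query_le (hR : S.R.Nonempty) {s : ℝ} (hs : 0 < s) {ι W E : Type}
    [Fintype ι] [DecidableEq ι] [Fintype E] (e : ι ≃ (Fin N × Bool) × W)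
    (M : Input N → Matrix ι E ℂ) (hM : ∀ z, mass (M z) ≤ 1) (a : Input N → ℝ)
    (ha : ∀ z, 0 ≤ a z) :
    ∑ p ∈ S.R, S.w p.1 p.2 * a p.1 * a p.2 * ‖overlap (M p.1) (M p.2) -
      overlap (phaseOracle p.1 e * M p.1) (phaseOracle p.2 e * M p.2)‖ ≤ S.queryBound s a := by
  have hX := sum_load_le S.R Prod.fst (fun p => S.w p.1 p.2)
    (fun p i => if p.1 i ≠ p.2 i then S.w' p.1 p.2 i else 0) S.vX (S.vX_pos hR).le
    (fun p hp => (S.w_pos _ _ hp).le) (fun t₀ ht₀ i => by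
      rw [S.sum_eq_loadX, S.sum_eq_wtX]
      exact (div_le_iff₀ (S.wtX_pos ht₀)).mp (S.load_div_wtX_le ht₀ i))
    (fun z (p : ι × E) => ‖M z p.1 p.2‖ ^ 2) (fun _ _ => by positivity) hM
    (fun p => (e p.1).1.1) a
  have hY := sum_load_le S.R Prod.snd (fun p => S.w p.1 p.2)
    (fun p i => if p.1 i ≠ p.2 i then S.w' p.2 p.1 i else 0) S.vY (S.vY_pos hR).le
    (fun p hp => (S.w_pos _ _ hp).le) (fun t₀ ht₀ i => by
      rw [S.sum_eq_loadY, S.sum_eq_wtY]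
      exact (div_le_iff₀ (S.wtY_pos ht₀)).mp (S.load_div_wtY_le ht₀ i))
    (fun z (p : ι × E) => ‖M z p.1 p.2‖ ^ 2) (fun _ _ => by positivity) hM
    (fun p => (e p.1).1.1) a
  refine le_trans ?_ (add_le_add (mul_le_mul_of_nonneg_left hX hs.le)
    (mul_le_mul_of_nonneg_left hY (inv_pos.mpr hs).le))
  simp only [Finset.mul_sum]
  rw [← Finset.sum_add_distrib]
  refine Finset.sum_le_sum fun t ht => ?_
  rw [← Finset.sum_add_distrib]
  have hw : 0 ≤ S.w t.1 t.2 * a t.1 * a t.2 :=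
    mul_nonneg (mul_nonneg (S.w_pos _ _ ht).le (ha _)) (ha _)
  refine (mul_le_mul_of_nonneg_left (norm_overlap_sub_query_le e _ _ _ _) hw).trans ?_
  rw [Finset.mul_sum]
  refine Finset.sum_le_sum fun p _ => ?_
  by_cases h : t.1 (e p.1).1.1 = t.2 (e p.1).1.1
  · simp [h]
  · simp only [if_pos h]
    have := two_mul_le_of_sq_le (u := a t.1 * ‖M t.1 p.1 p.2‖) (v := a t.2 * ‖M t.2 p.1 p.2‖) hs
      (S.w'_pos_left _ _ _ ht h).le (S.w'_pos_right _ _ _ ht h).le (S.w_sq_le _ _ _ ht h)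
    rw [mul_pow, mul_pow] at this
    refine le_trans (le_of_eq ?_) this
    ring

end WeightScheme

end Progress

/-! ### The adversary argument: deficit, induction on circuits, weighted bound. -/

section Adversary

open Matrix

variable {N : ℕ}

namespace WeightScheme

variable {f : Input N → Bool} (S : WeightScheme f)

theorem queryBound_nonneg (hR : S.R.Nonempty) {s : ℝ} (hs : 0 < s) (a : Input N → ℝ) :
    0 ≤ S.queryBound s a := by
  have hX := (S.vX_pos hR).le
  have hY := (S.vY_pos hR).le
  have h : ∀ z : Input N × Input N → Input N, 0 ≤ ∑ p ∈ S.R, S.w p.1 p.2 * a (z p) ^ 2 := fun z =>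
    Finset.sum_nonneg fun p hp => mul_nonneg (S.w_pos _ _ hp).le (sq_nonneg _)
  have h₁ := h Prod.fst
  have h₂ := h Prod.snd
  unfold queryBound
  positivity

/-- The bound is linear in the branch probabilities `a z ^ 2`, which a measurement only subdivides.
Hence branching does not multiply the cost of queries. -/
theorem sum_queryBound_le (hR : S.R.Nonempty) {s : ℝ} (hs : 0 < s) {κ : Type*} [Fintype κ]
    (a : Input N → ℝ) (q : κ → Input N → ℝ) (hq : ∀ n z, 0 ≤ q n z) (hq₁ : ∀ z, ∑ n, q n z ≤ 1) :
    ∑ n, S.queryBound s (fun z => a z * √(q n z)) ≤ S.queryBound s a := by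
  have hX := (S.vX_pos hR).le
  have hY := (S.vY_pos hR).le
  have h : ∀ z : Input N × Input N → Input N,
      ∑ n, ∑ p ∈ S.R, S.w p.1 p.2 * (a (z p) * √(q n (z p))) ^ 2 ≤
        ∑ p ∈ S.R, S.w p.1 p.2 * a (z p) ^ 2 := by
    intro z
    rw [Finset.sum_comm]
    refine Finset.sum_le_sum fun p hp => ?_
    simp only [mul_pow, Real.sq_sqrt (hq _ _)]
    rw [← Finset.mul_sum, ← Finset.mul_sum]
    exact mul_le_mul_of_nonneg_left (mul_le_of_le_one_right (sq_nonneg _) (hq₁ _))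
      (S.w_pos _ _ hp).le
  unfold queryBound
  rw [Finset.sum_add_distrib, ← Finset.mul_sum, ← Finset.mul_sum, ← Finset.mul_sum,
    ← Finset.mul_sum]
  have h₁ := h Prod.fst
  have h₂ := h Prod.snd
  gcongr

theorem weight_nonneg {a : Input N → ℝ} (ha : ∀ z, 0 ≤ a z) {p : Input N × Input N}
    (hp : p ∈ S.R) : 0 ≤ S.w p.1 p.2 * a p.1 * a p.2 :=
  mul_nonneg (mul_nonneg (S.w_pos _ _ hp).le (ha _)) (ha _)

/-- The weighted deficit of the inner products of a family of purifications. -/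
noncomputable def deficit {ι E : Type} [Fintype ι] [Fintype E] (a : Input N → ℝ)
    (M : Input N → Matrix ι E ℂ) : ℝ :=
  ∑ p ∈ S.R, S.w p.1 p.2 * a p.1 * a p.2 * (1 - ‖overlap (M p.1) (M p.2)‖)

theorem deficit_nonneg {ι E : Type} [Fintype ι] [Fintype E] {a : Input N → ℝ}
    (ha : ∀ z, 0 ≤ a z) {M : Input N → Matrix ι E ℂ} (hM : ∀ z, mass (M z) ≤ 1) :
    0 ≤ S.deficit a M :=
  Finset.sum_nonneg fun _ hp => mul_nonneg (S.weight_nonneg ha hp)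
    (sub_nonneg.mpr (norm_overlap_le_one (hM _) (hM _)))

/-- Overlaps are squared, and `1 - t² ≤ 2(1 - t)` is `(1 - t)² ≥ 0`. -/
theorem deficit_copied_le {ι E A B : Type} [Fintype ι] [Fintype E] [Fintype A] [Fintype B]
    (e : ι ≃ A × B) {a : Input N → ℝ} (ha : ∀ z, 0 ≤ a z) (M : Input N → Matrix ι E ℂ) :
    S.deficit a (fun z => copied e (M z)) ≤ 2 * S.deficit a M := by
  unfold deficit
  rw [Finset.mul_sum]
  refine Finset.sum_le_sum fun p hp => ?_
  rw [overlap_copied, norm_pow, mul_left_comm]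
  refine mul_le_mul_of_nonneg_left ?_ (S.weight_nonneg ha hp)
  linarith [sq_nonneg (1 - ‖overlap (M p.1) (M p.2)‖)]

theorem deficit_query_le (hR : S.R.Nonempty) {s : ℝ} (hs : 0 < s) {ι W E : Type}
    [Fintype ι] [DecidableEq ι] [Fintype E] (e : ι ≃ (Fin N × Bool) × W)
    (M : Input N → Matrix ι E ℂ) (hM : ∀ z, mass (M z) ≤ 1) (a : Input N → ℝ)
    (ha : ∀ z, 0 ≤ a z) :
    S.deficit a (fun z => phaseOracle z e * M z) ≤ S.deficit a M + S.queryBound s a := by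
  refine le_trans ?_ (add_le_add_right (S.sum_norm_overlap_sub_query_le hR hs e M hM a ha) _)
  unfold deficit
  rw [← Finset.sum_add_distrib]
  refine Finset.sum_le_sum fun p hp => ?_
  rw [← mul_add]
  refine mul_le_mul_of_nonneg_left ?_ (S.weight_nonneg ha hp)
  linarith [norm_sub_norm_le (overlap (M p.1) (M p.2))
    (overlap (phaseOracle p.1 e * M p.1) (phaseOracle p.2 e * M p.2))]

/-- The central induction. It is stated for all environments, states and amplitudes `a`, because
copies enlarge the environment and measurements rescale `a` by square roots of outcome
probabilities. -/
theorem affinity_loss_le (hR : S.R.Nonempty) {s : ℝ} (hs : 0 < s) {ι : Type} [Fintype ι]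
    [DecidableEq ι] (C : Circuit N ι) :
    ∀ {E : Type} [Fintype E] (M : Input N → Matrix ι E ℂ), (∀ z, mass (M z) ≤ 1) →
      ∀ a : Input N → ℝ, (∀ z, 0 ≤ a z) →
      ∑ p ∈ S.R, S.w p.1 p.2 * a p.1 * a p.2 *
          (1 - C.affinity p.1 p.2 (M p.1 * (M p.1)ᴴ) (M p.2 * (M p.2)ᴴ)) ≤
        2 ^ C.copies * (S.deficit a M + C.queries * S.queryBound s a) := by
  induction C with
  | output g =>
    intro E _ M hM a ha
    simp only [Circuit.copies, Circuit.queries, Nat.cast_zero, zero_mul, add_zero, pow_zero,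
      one_mul]
    refine Finset.sum_le_sum fun p hp => mul_le_mul_of_nonneg_left ?_ (S.weight_nonneg ha hp)
    simp only [Circuit.affinity, Circuit.outProb, outcomeProb_purified]
    refine sub_le_sub_left ?_ _
    -- The overlap splits over the output bit, and Cauchy–Schwarz bounds each piece: the affinity is
    -- at least the modulus of the overlap.
    rw [← sum_overlap_proj g]
    refine (norm_sum_le _ _).trans (Finset.sum_le_sum fun b _ => ?_)
    rw [← Real.sqrt_mul (mass_nonneg _)]
    exact norm_overlap_le _ _
  | unitary U k ih =>
    intro E _ M hM a ha
    have hU := Matrix.mem_unitaryGroup_iff'.mp U.2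
    simp only [Circuit.affinity, Circuit.outProb, conj_purified, Circuit.copies, Circuit.queries]
    refine (ih (fun z => U.1 * M z) (fun z => ?_) a ha).trans (le_of_eq ?_)
    · rw [mass_mul_of_isometry _ hU]
      exact hM z
    · simp only [deficit, overlap_mul_of_isometry _ hU]
  | query e k ih =>
    intro E _ M hM a ha
    simp only [Circuit.affinity, Circuit.outProb, conj_purified, Circuit.copies, Circuit.queries]
    refine (ih (fun z => phaseOracle z e * M z) (fun z => ?_) a ha).trans ?_
    · rw [mass_mul_of_isometry _ (phaseOracle_isometry z e)]
      exact hM z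
    · have := S.deficit_query_le hR hs e M hM a ha
      refine mul_le_mul_of_nonneg_left ?_ (by positivity)
      push_cast
      linarith
  | measure m k ih =>
    intro E _ M hM a ha
    set r : _ → Input N → ℝ := fun n z => mass (proj m n * M z) with hr
    have hr₀ : ∀ n z, 0 ≤ r n z := fun n z => mass_nonneg _
    have hr₁ : ∀ z, ∑ n, r n z ≤ 1 := fun z => (sum_mass_proj m (M z)).trans_le (hM z)
    -- `T` is the distinguishability already revealed by the measurement outcome. It enters both the
    -- loss (`hloss`) and the old deficit (`hdef`).
    set T : Input N × Input N → ℝ := fun p => 1 - ∑ n, √(r n p.1) * √(r n p.2) with hT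
    have hT₀ : ∀ p, 0 ≤ T p := fun p => sub_nonneg.mpr (sum_sqrt_mul_sqrt_le_one _ _
      (fun n => hr₀ n _) (fun n => hr₀ n _) (hr₁ _) (hr₁ _))
    have hT₁ : 0 ≤ ∑ p ∈ S.R, S.w p.1 p.2 * a p.1 * a p.2 * T p :=
      Finset.sum_nonneg fun p hp => mul_nonneg (S.weight_nonneg ha hp) (hT₀ p)
    set Z := Circuit.measure m k with hZ
    have hcop : ∀ n, (k n).copies ≤ Z.copies := fun n =>
      Finset.le_sup (f := fun n => (k n).copies) (Finset.mem_univ n)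
    have hque : ∀ n, (k n).queries ≤ Z.queries := fun n =>
      Finset.le_sup (f := fun n => (k n).queries) (Finset.mem_univ n)
    have hbranch : ∀ n, ∑ p ∈ S.R, S.w p.1 p.2 * (a p.1 * √(r n p.1)) * (a p.2 * √(r n p.2)) *
        (1 - (k n).affinity p.1 p.2 (collapsed m n (M p.1) * (collapsed m n (M p.1))ᴴ)
          (collapsed m n (M p.2) * (collapsed m n (M p.2))ᴴ)) ≤
        2 ^ Z.copies * (S.deficit (fun z => a z * √(r n z)) (fun z => collapsed m n (M z)) +
          Z.queries * S.queryBound s (fun z => a z * √(r n z))) := by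
      intro n
      have ha' : ∀ z, 0 ≤ a z * √(r n z) := fun z => mul_nonneg (ha z) (Real.sqrt_nonneg _)
      refine (ih n (fun z => collapsed m n (M z)) (fun z => mass_collapsed_le_one _ _ _)
        (fun z => a z * √(r n z)) ha').trans ?_
      have h₁ := S.deficit_nonneg ha' (M := fun z => collapsed m n (M z))
        (fun z => mass_collapsed_le_one _ _ _)
      have h₂ := S.queryBound_nonneg hR hs (fun z => a z * √(r n z))
      have h₃ : ((k n).queries : ℝ) ≤ Z.queries := Nat.cast_le.mpr (hque n)
      have h₄ : (2 : ℝ) ^ (k n).copies ≤ 2 ^ Z.copies :=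
        pow_le_pow_right₀ one_le_two (hcop n)
      gcongr
    have hpull : ∀ (p : Input N × Input N) (q : _ → ℝ),
        ∑ n, S.w p.1 p.2 * (a p.1 * √(r n p.1)) * (a p.2 * √(r n p.2)) *
        (1 - q n) = S.w p.1 p.2 * a p.1 * a p.2 * (∑ n, √(r n p.1) * √(r n p.2) -
          ∑ n, √(r n p.1) * √(r n p.2) * q n) := by
      intro p q
      rw [← Finset.sum_sub_distrib, Finset.mul_sum]
      exact Finset.sum_congr rfl fun n _ => by ring
    have hloss : ∑ p ∈ S.R, S.w p.1 p.2 * a p.1 * a p.2 *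
          (1 - Z.affinity p.1 p.2 (M p.1 * (M p.1)ᴴ) (M p.2 * (M p.2)ᴴ)) ≤
        ∑ p ∈ S.R, S.w p.1 p.2 * a p.1 * a p.2 * T p +
        ∑ n, ∑ p ∈ S.R, S.w p.1 p.2 * (a p.1 * √(r n p.1)) * (a p.2 * √(r n p.2)) *
        (1 - (k n).affinity p.1 p.2 (collapsed m n (M p.1) * (collapsed m n (M p.1))ᴴ)
          (collapsed m n (M p.2) * (collapsed m n (M p.2))ᴴ)) := by
      rw [Finset.sum_comm (s := Finset.univ), ← Finset.sum_add_distrib]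
      refine Finset.sum_le_sum fun p hp => ?_
      have h := Circuit.affinity_measure_ge m k p.1 p.2 (M p.1) (M p.2)
      refine (mul_le_mul_of_nonneg_left (sub_le_sub_left h 1)
        (S.weight_nonneg ha hp)).trans (le_of_eq ?_)
      rw [hpull, hT]
      ring
    have hdef : ∑ p ∈ S.R, S.w p.1 p.2 * a p.1 * a p.2 * T p +
        ∑ n, S.deficit (fun z => a z * √(r n z)) (fun z => collapsed m n (M z)) ≤
        S.deficit a M := by
      unfold deficit
      rw [Finset.sum_comm (s := Finset.univ), ← Finset.sum_add_distrib]
      refine Finset.sum_le_sum fun p hp => ?_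
      have h : ‖overlap (M p.1) (M p.2)‖ ≤ ∑ n, √(r n p.1) * √(r n p.2) *
          ‖overlap (collapsed m n (M p.1)) (collapsed m n (M p.2))‖ := by
        rw [← sum_overlap_proj m]
        refine (norm_sum_le _ _).trans (le_of_eq (Finset.sum_congr rfl fun n _ => ?_))
        exact (norm_overlap_collapsed m n _ _).symm
      refine le_trans (le_of_eq ?_) (mul_le_mul_of_nonneg_left (sub_le_sub_left h 1)
        (S.weight_nonneg ha hp))
      rw [hpull, hT]
      ring
    have hquery := S.sum_queryBound_le hR hs a r hr₀ hr₁
    have hpow : (1 : ℝ) ≤ 2 ^ Z.copies := one_le_pow₀ one_le_two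
    -- The term with `T` is nonnegative, so it may be given the factor `2 ^ Z.copies` as well; it
    -- then joins the branch deficits to form the old deficit.
    calc _ ≤ _ := hloss
      _ ≤ 2 ^ Z.copies * ∑ p ∈ S.R, S.w p.1 p.2 * a p.1 * a p.2 * T p +
          ∑ n, 2 ^ Z.copies * (S.deficit (fun z => a z * √(r n z)) (fun z => collapsed m n (M z)) +
          Z.queries * S.queryBound s (fun z => a z * √(r n z))) :=
        add_le_add (le_mul_of_one_le_left hT₁ hpow) (Finset.sum_le_sum fun n _ => hbranch n)
      _ = 2 ^ Z.copies * ((∑ p ∈ S.R, S.w p.1 p.2 * a p.1 * a p.2 * T p +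
          ∑ n, S.deficit (fun z => a z * √(r n z)) (fun z => collapsed m n (M z))) +
          Z.queries * ∑ n, S.queryBound s (fun z => a z * √(r n z))) := by
        rw [← Finset.mul_sum, Finset.sum_add_distrib, ← Finset.mul_sum]
        ring
      _ ≤ _ := by gcongr
  | copy e k ih =>
    intro E _ M hM a ha
    simp only [Circuit.affinity, Circuit.outProb, copy_purified, Circuit.copies, Circuit.queries]
    refine (ih (fun z => copied e (M z)) (fun z => mass_copied_le_one e (hM z)) a ha).trans ?_
    -- The extra factor two pays for the doubled deficit, and the query term can only gain from it.
    rw [pow_succ, mul_assoc]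
    refine mul_le_mul_of_nonneg_left ?_ (by positivity)
    have h₁ := S.deficit_copied_le e ha M
    have h₂ : 0 ≤ (k.queries : ℝ) * S.queryBound s a :=
      mul_nonneg (Nat.cast_nonneg _) (S.queryBound_nonneg hR hs a)
    linarith

end WeightScheme

/-- The right side is at least `((√p - √q)² + (√p' - √q')²) / 2`, and `1 - 2ε ≤ p - q ≤ 2(√p - √q)`.
-/
theorem affinity_le_of_solves {p p' q q' ε : ℝ} (hε : ε < 1 / 2) (hp : 1 - ε ≤ p) (hp' : 0 ≤ p')
    (hq : 0 ≤ q) (hq' : 1 - ε ≤ q') (hpp : p + p' ≤ 1) (hqq : q + q' ≤ 1) :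
    (1 - 2 * ε) ^ 2 / 8 ≤ 1 - (√p * √q + √p' * √q') := by
  have hp0 : 0 ≤ p := by linarith
  have hq0 : 0 ≤ q' := by linarith
  have e₁ := Real.sq_sqrt hp0
  have e₂ := Real.sq_sqrt hp'
  have e₃ := Real.sq_sqrt hq
  have e₄ := Real.sq_sqrt hq0
  have h₁ : √p ≤ 1 := Real.sqrt_le_one.mpr (by linarith)
  have h₂ : √q ≤ 1 := Real.sqrt_le_one.mpr (by linarith)
  have h₃ : √q ≤ √p := Real.sqrt_le_sqrt (by linarith)
  have h₄ : 1 - 2 * ε ≤ 2 * (√p - √q) := by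
    have : (√p - √q) * (√p + √q) ≤ (√p - √q) * 2 :=
      mul_le_mul_of_nonneg_left (by linarith) (by linarith)
    nlinarith
  have h₅ : (1 - 2 * ε) ^ 2 ≤ (2 * (√p - √q)) ^ 2 := pow_le_pow_left₀ (by linarith) h₄ 2
  nlinarith [sq_nonneg (√p' - √q')]

theorem WeightScheme.queries_mul_two_pow_copies_ge {f : Input N → Bool} (S : WeightScheme f)
    (hR : S.R.Nonempty) {ε : ℝ} (hε : ε < 1 / 2) (A : Algorithm N) (hA : A.Solves f ε) :
    (1 - 2 * ε) ^ 2 / 16 * (1 / S.vmax) ≤ (A.queries : ℝ) * 2 ^ A.copies := by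
  have hX := S.vX_pos hR
  have hY := S.vY_pos hR
  -- This `s` makes `s · vX` and `s⁻¹ · vY` both equal to `vmax`.
  have hs : 0 < √(S.vY / S.vX) := Real.sqrt_pos.mpr (div_pos hY hX)
  let M : Matrix A.ι Unit ℂ := Matrix.single A.start () 1
  have hMM : M * Mᴴ = Matrix.single A.start A.start 1 := by
    simp [M]
  have hMo : overlap M M = 1 := by
    rw [overlap]
    simp [M]
  have hM : mass M ≤ 1 := by
    rw [mass_eq_re_overlap, hMo, Complex.one_re]
  have hmain := S.affinity_loss_le hR hs A.circuit (fun _ => M) (fun _ => hM) (fun _ => 1)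
    (fun _ => zero_le_one)
  have hW : 0 < ∑ p ∈ S.R, S.w p.1 p.2 := Finset.sum_pos (fun p hp => S.w_pos _ _ hp) hR
  -- The start state does not depend on the input.
  have hdef : S.deficit (fun _ => 1) (fun _ => M) = 0 := by
    simp [deficit, hMo]
  have hbal : √(S.vY / S.vX) * S.vX = S.vmax ∧ (√(S.vY / S.vX))⁻¹ * S.vY = S.vmax := by
    have hx := Real.mul_self_sqrt hX.le
    have hy := Real.mul_self_sqrt hY.le
    have hx' : √S.vX ≠ 0 := (Real.sqrt_pos.mpr hX).ne'
    have hy' : √S.vY ≠ 0 := (Real.sqrt_pos.mpr hY).ne'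
    rw [WeightScheme.vmax, Real.sqrt_mul hX.le, Real.sqrt_div hY.le]
    constructor
    · nth_rw 2 [← hx]
      field_simp
    · nth_rw 2 [← hy]
      field_simp
  have hq : S.queryBound (√(S.vY / S.vX)) (fun _ => 1) =
      2 * S.vmax * ∑ p ∈ S.R, S.w p.1 p.2 := by
    simp only [queryBound, one_pow, mul_one]
    rw [← mul_assoc, ← mul_assoc, hbal.1, hbal.2]
    ring
  rw [hdef, hq, zero_add] at hmain
  have hlow : (1 - 2 * ε) ^ 2 / 8 * ∑ p ∈ S.R, S.w p.1 p.2 ≤ ∑ p ∈ S.R, S.w p.1 p.2 * 1 * 1 *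
      (1 - A.circuit.affinity p.1 p.2 (M * Mᴴ) (M * Mᴴ)) := by
    rw [Finset.mul_sum]
    refine Finset.sum_le_sum fun p hp => ?_
    rw [mul_one, mul_one, mul_comm]
    refine mul_le_mul_of_nonneg_left ?_ (S.w_pos _ _ hp).le
    obtain ⟨hx, hy⟩ := Finset.mem_product.mp (S.R_sub hp)
    have h₁ := hA p.1
    have h₂ := hA p.2
    rw [S.X_sub _ hx, Algorithm.outProb, ← hMM] at h₁
    rw [S.Y_sub _ hy, Algorithm.outProb, ← hMM] at h₂
    obtain ⟨hx₀, hx₁⟩ := A.circuit.outProb_nonneg_and_sum_le p.1 M hM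
    obtain ⟨hy₀, hy₁⟩ := A.circuit.outProb_nonneg_and_sum_le p.2 M hM
    rw [Fintype.sum_bool, add_comm] at hx₁ hy₁
    rw [Circuit.affinity, Fintype.sum_bool, add_comm (√_ * √_)]
    exact affinity_le_of_solves hε h₁ (hx₀ _) (hy₀ _) h₂ hx₁ hy₁
  have hfin := hlow.trans hmain
  have hv := S.vmax_pos hR
  rw [mul_one_div, div_le_iff₀ hv]
  have : (1 - 2 * ε) ^ 2 / 8 ≤ 2 * (A.queries * 2 ^ A.copies * S.vmax) := by
    refine le_of_mul_le_mul_right (hfin.trans (le_of_eq ?_)) hW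
    simp only [Algorithm.queries, Algorithm.copies]
    ring
  linarith

end Adversary

/-! ### The unweighted bound and search -/

section Unweighted

variable {N : ℕ}

/-- The weight scheme with all weights equal to one. -/
def unitScheme (f : Input N → Bool) (X Y : Finset (Input N)) (R : Finset (Input N × Input N))
    (hX : ∀ x ∈ X, f x = false) (hY : ∀ y ∈ Y, f y = true) (hR : R ⊆ X ×ˢ Y) :
    WeightScheme f where
  X := X
  Y := Y
  R := R
  X_sub := hX
  Y_sub := hY
  R_sub := hR
  w _ _ := 1
  w' _ _ _ := 1
  w_pos _ _ _ := one_pos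
  w'_pos_left _ _ _ _ _ := one_pos
  w'_pos_right _ _ _ _ _ := one_pos
  w_sq_le _ _ _ _ _ := by norm_num

variable {f : Input N → Bool} {X Y : Finset (Input N)} {R : Finset (Input N × Input N)}

theorem card_le_maxDiffX (x : X) (i : Fin N) :
    (R.filter fun p => p.1 = x.1 ∧ p.1 i ≠ p.2 i).card ≤ maxDiffX X R :=
  le_ciSup (f := fun q : X × Fin N => (R.filter fun p => p.1 = q.1.1 ∧ p.1 q.2 ≠ p.2 q.2).card)
    (Set.finite_range _).bddAbove (x, i)

theorem card_le_maxDiffY (y : Y) (i : Fin N) :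
    (R.filter fun p => p.2 = y.1 ∧ p.1 i ≠ p.2 i).card ≤ maxDiffY Y R :=
  le_ciSup (f := fun q : Y × Fin N => (R.filter fun p => p.2 = q.1.1 ∧ p.1 q.2 ≠ p.2 q.2).card)
    (Set.finite_range _).bddAbove (y, i)

theorem minDegX_le_card (x : X) : minDegX X R ≤ (R.filter fun p => p.1 = x.1).card :=
  ciInf_le (OrderBot.bddBelow _) x

theorem minDegY_le_card (y : Y) : minDegY Y R ≤ (R.filter fun p => p.2 = y.1).card :=
  ciInf_le (OrderBot.bddBelow _) y

theorem maxDiff_pos (hX : ∀ x ∈ X, f x = false) (hY : ∀ y ∈ Y, f y = true) (hR : R ⊆ X ×ˢ Y)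
    (hne : R.Nonempty) : 0 < maxDiffX X R ∧ 0 < maxDiffY Y R := by
  obtain ⟨p, hp⟩ := hne
  obtain ⟨i, hi⟩ := (unitScheme f X Y R hX hY hR).exists_ne hp
  obtain ⟨hx, hy⟩ := Finset.mem_product.mp (hR hp)
  exact ⟨(Finset.card_pos.mpr ⟨p, Finset.mem_filter.mpr ⟨hp, rfl, hi⟩⟩).trans_le
    (card_le_maxDiffX ⟨p.1, hx⟩ i), (Finset.card_pos.mpr ⟨p, Finset.mem_filter.mpr
    ⟨hp, rfl, hi⟩⟩).trans_le (card_le_maxDiffY ⟨p.2, hy⟩ i)⟩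

theorem unitScheme_vX_le (hX : ∀ x ∈ X, f x = false) (hY : ∀ y ∈ Y, f y = true)
    (hR : R ⊆ X ×ˢ Y) (hm : 0 < minDegX X R) :
    (unitScheme f X Y R hX hY hR).vX ≤ (maxDiffX X R : ℝ) / minDegX X R := by
  refine Real.iSup_le (fun q => ?_) (by positivity)
  have hl : (unitScheme f X Y R hX hY hR).loadX q.1 q.2 ≤ maxDiffX X R := by
    simp only [WeightScheme.loadX, unitScheme, Finset.sum_const, nsmul_eq_mul, mul_one]
    refine Nat.cast_le.mpr (le_trans (le_of_eq ?_) (card_le_maxDiffX q.1 q.2))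
    exact congrArg _ (Finset.filter_congr fun p _ => and_congr_right fun h => by rw [h])
  have hw : (minDegX X R : ℝ) ≤ (unitScheme f X Y R hX hY hR).wtX q.1 := by
    simp only [WeightScheme.wtX, unitScheme, Finset.sum_const, nsmul_eq_mul, mul_one]
    exact Nat.cast_le.mpr (minDegX_le_card q.1)
  have hm' : (0 : ℝ) < minDegX X R := Nat.cast_pos.mpr hm
  exact div_le_div₀ (Nat.cast_nonneg _) hl hm' hw

theorem unitScheme_vY_le (hX : ∀ x ∈ X, f x = false) (hY : ∀ y ∈ Y, f y = true)
    (hR : R ⊆ X ×ˢ Y) (hm : 0 < minDegY Y R) :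
    (unitScheme f X Y R hX hY hR).vY ≤ (maxDiffY Y R : ℝ) / minDegY Y R := by
  refine Real.iSup_le (fun q => ?_) (by positivity)
  have hl : (unitScheme f X Y R hX hY hR).loadY q.1 q.2 ≤ maxDiffY Y R := by
    simp only [WeightScheme.loadY, unitScheme, Finset.sum_const, nsmul_eq_mul, mul_one]
    refine Nat.cast_le.mpr (le_trans (le_of_eq ?_) (card_le_maxDiffY q.1 q.2))
    exact congrArg _ (Finset.filter_congr fun p _ => and_congr_right fun h => by rw [h])
  have hw : (minDegY Y R : ℝ) ≤ (unitScheme f X Y R hX hY hR).wtY q.1 := by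
    simp only [WeightScheme.wtY, unitScheme, Finset.sum_const, nsmul_eq_mul, mul_one]
    exact Nat.cast_le.mpr (minDegY_le_card q.1)
  have hm' : (0 : ℝ) < minDegY Y R := Nat.cast_pos.mpr hm
  exact div_le_div₀ (Nat.cast_nonneg _) hl hm' hw

theorem unweighted_bound (hX : ∀ x ∈ X, f x = false) (hY : ∀ y ∈ Y, f y = true)
    (hR : R ⊆ X ×ˢ Y) (hne : R.Nonempty) {ε : ℝ} (hε : ε < 1 / 2) (A : Algorithm N)
    (hA : A.Solves f ε) :
    (1 - 2 * ε) ^ 2 / 16 * √((minDegX X R * minDegY Y R : ℝ) / (maxDiffX X R * maxDiffY Y R : ℝ)) ≤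
      (A.queries : ℝ) * 2 ^ A.copies := by
  -- If a minimal degree is zero the bound is trivial; otherwise the unit scheme has `vX ≤ l/m` and
  -- `vY ≤ l'/m'`.
  rcases Nat.eq_zero_or_pos (minDegX X R) with hm | hm
  · rw [hm, Nat.cast_zero, zero_mul, zero_div, Real.sqrt_zero, mul_zero]
    positivity
  rcases Nat.eq_zero_or_pos (minDegY Y R) with hm' | hm'
  · rw [hm', Nat.cast_zero, mul_zero, zero_div, Real.sqrt_zero, mul_zero]
    positivity
  obtain ⟨hl, hl'⟩ := maxDiff_pos hX hY hR hne
  refine le_trans (mul_le_mul_of_nonneg_left ?_ (by positivity))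
    ((unitScheme f X Y R hX hY hR).queries_mul_two_pow_copies_ge hne hε A hA)
  have hvX := unitScheme_vX_le hX hY hR hm
  have hvY := unitScheme_vY_le hX hY hR hm'
  have hv := (unitScheme f X Y R hX hY hR).vmax_pos hne
  rw [le_div_iff₀ hv, WeightScheme.vmax, ← Real.sqrt_mul (by positivity), Real.sqrt_le_one]
  calc _ ≤ (minDegX X R * minDegY Y R : ℝ) / (maxDiffX X R * maxDiffY Y R : ℝ) *
        ((maxDiffX X R : ℝ) / minDegX X R * ((maxDiffY Y R : ℝ) / minDegY Y R)) := by
        have := ((unitScheme f X Y R hX hY hR).vY_pos hne).le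
        gcongr
    _ = 1 := by
        have h₁ : (minDegX X R : ℝ) ≠ 0 := by positivity
        have h₂ : (minDegY Y R : ℝ) ≠ 0 := by positivity
        have h₃ : (maxDiffX X R : ℝ) ≠ 0 := by positivity
        have h₄ : (maxDiffY Y R : ℝ) ≠ 0 := by positivity
        field_simp

/-- The input whose only marked position is `i`. -/
def oneMarked (i : Fin N) : Input N := fun j => decide (j = i)

theorem oneMarked_injective : Function.Injective (oneMarked (N := N)) := by
  intro i j h
  have := congrFun h i
  simpa [oneMarked] using this

/-- The zero string is paired with all one-marked strings, so `m = N` and `m' = l = l' = 1`. -/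
theorem search_bound {ε : ℝ} (hε : ε < 1 / 2) (A : Algorithm N) (hA : A.Solves (search N) ε) :
    (1 - 2 * ε) ^ 2 / 16 * √N ≤ (A.queries : ℝ) * 2 ^ A.copies := by
  rcases Nat.eq_zero_or_pos N with rfl | hN
  · rw [Nat.cast_zero, Real.sqrt_zero, mul_zero]
    positivity
  let X : Finset (Input N) := {fun _ => false}
  let Y : Finset (Input N) := Finset.univ.image oneMarked
  have hX : ∀ x ∈ X, search N x = false := by
    intro x hx
    rw [Finset.mem_singleton.mp hx]
    simp [search]
  have hY : ∀ y ∈ Y, search N y = true := by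
    intro y hy
    obtain ⟨i, -, rfl⟩ := Finset.mem_image.mp hy
    simp [search, oneMarked]
  have hne : (X ×ˢ Y).Nonempty :=
    ⟨(fun _ => false, oneMarked ⟨0, hN⟩), by simp [X, Y]⟩
  obtain ⟨hl, hl'⟩ := maxDiff_pos hX hY subset_rfl hne
  have : Nonempty X := ⟨⟨fun _ => false, Finset.mem_singleton_self _⟩⟩
  have : Nonempty Y := ⟨⟨oneMarked ⟨0, hN⟩, Finset.mem_image_of_mem _ (Finset.mem_univ _)⟩⟩
  have : Nonempty (Fin N) := ⟨⟨0, hN⟩⟩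
  have hm : N ≤ minDegX X (X ×ˢ Y) := by
    refine le_ciInf fun x => ?_
    rw [Finset.filter_true_of_mem]
    · rw [Finset.card_product, Finset.card_singleton, one_mul,
        Finset.card_image_of_injective _ oneMarked_injective, Finset.card_univ, Fintype.card_fin]
    · intro p hp
      rw [Finset.mem_singleton.mp (Finset.mem_product.mp hp).1, Finset.mem_singleton.mp x.2]
  have hm' : 1 ≤ minDegY Y (X ×ˢ Y) := by
    refine le_ciInf fun y => Finset.card_pos.mpr ⟨(fun _ => false, y.1), ?_⟩
    simp [X]
  have hL : maxDiffX X (X ×ˢ Y) ≤ 1 := by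
    refine ciSup_le fun q => Finset.card_le_one.mpr ?_
    have key : ∀ p ∈ ((X ×ˢ Y).filter fun p => p.1 = q.1.1 ∧ p.1 q.2 ≠ p.2 q.2),
        p = (fun _ => false, oneMarked q.2) := by
      intro p hp
      obtain ⟨hp, -, hi⟩ := Finset.mem_filter.mp hp
      obtain ⟨hx, hy⟩ := Finset.mem_product.mp hp
      obtain ⟨j, -, hj⟩ := Finset.mem_image.mp hy
      have hx := Finset.mem_singleton.mp hx
      rw [hx, ← hj] at hi
      have : q.2 = j := by simpa [oneMarked] using hi
      exact Prod.ext hx (by rw [← hj, this])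
    intro p hp p' hp'
    rw [key p hp, key p' hp']
  have hL' : maxDiffY Y (X ×ˢ Y) ≤ 1 := by
    refine ciSup_le fun q => Finset.card_le_one.mpr ?_
    have key : ∀ p ∈ ((X ×ˢ Y).filter fun p => p.2 = q.1.1 ∧ p.1 q.2 ≠ p.2 q.2),
        p = (fun _ => false, q.1.1) := by
      intro p hp
      obtain ⟨hp, hq, -⟩ := Finset.mem_filter.mp hp
      exact Prod.ext (Finset.mem_singleton.mp (Finset.mem_product.mp hp).1) hq
    intro p hp p' hp'
    rw [key p hp, key p' hp']
  have hL1 : maxDiffX X (X ×ˢ Y) = 1 := le_antisymm hL hl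
  have hL1' : maxDiffY Y (X ×ˢ Y) = 1 := le_antisymm hL' hl'
  have h := unweighted_bound hX hY subset_rfl hne hε A hA
  refine le_trans (mul_le_mul_of_nonneg_left (Real.sqrt_le_sqrt ?_) (by positivity)) h
  rw [hL1, hL1', Nat.cast_one, mul_one, div_one]
  have h₁ : (N : ℝ) ≤ minDegX X (X ×ˢ Y) := Nat.cast_le.mpr hm
  have h₂ : (1 : ℝ) ≤ minDegY Y (X ×ˢ Y) := by exact_mod_cast hm'
  nlinarith [Nat.cast_nonneg (α := ℝ) N]

/-- Logarithms give `log c + (log N)/2 ≤ P log 2 ≤ P`; for large `N`, half of `(log N)/2` absorbs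
`log c`. -/
theorem copies_ge_of_bound {c : ℝ} (hc : 0 < c) : ∃ N₀ : ℕ, ∀ N : ℕ, N₀ ≤ N → ∀ Q P : ℕ,
    c * √N ≤ (Q : ℝ) * 2 ^ P → Q ≤ 1 → 1 / 4 * Real.log N ≤ P := by
  have htend : Filter.Tendsto (fun N : ℕ => 1 / 4 * Real.log N) Filter.atTop Filter.atTop :=
    (Real.tendsto_log_atTop.comp tendsto_natCast_atTop_atTop).const_mul_atTop (by norm_num)
  obtain ⟨N₀, hN₀⟩ := Filter.eventually_atTop.mp
    ((htend.eventually_ge_atTop (-Real.log c)).and (Filter.eventually_ge_atTop 1))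
  refine ⟨N₀, fun N hN Q P h hQ => ?_⟩
  obtain ⟨hlog, hN1⟩ := hN₀ N hN
  have hNpos : (0 : ℝ) < N := by exact_mod_cast hN1
  have hQ' : (Q : ℝ) ≤ 1 := by exact_mod_cast hQ
  have h₁ : c * √N ≤ 2 ^ P := h.trans (mul_le_of_le_one_left (by positivity) hQ')
  have h₂ := Real.log_le_log (mul_pos hc (Real.sqrt_pos.mpr hNpos)) h₁
  rw [Real.log_mul hc.ne' (Real.sqrt_pos.mpr hNpos).ne', Real.log_sqrt hNpos.le, Real.log_pow] at h₂
  have h₃ : (P : ℝ) * Real.log 2 ≤ P :=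
    mul_le_of_le_one_right (Nat.cast_nonneg _) (by linarith [Real.log_two_lt_d9])
  linarith

end Unweighted

/-! ### Searching with one query -/

section SearchAlgorithm

open Matrix

variable {N : ℕ}

/-- Copy the whole system `k` times, then output `true` if `g` holds for some part. -/
def copyAll : (k : ℕ) → {ι : Type} → [Fintype ι] → [DecidableEq ι] → (ι → Bool) → Circuit N ι
  | 0, _, _, _, g => Circuit.output g
  | k + 1, ι, _, _, g =>
    Circuit.copy (Equiv.prodPUnit.{0, 0} ι).symm (copyAll k fun q : ι × ι => g q.1 || g q.2)

theorem queries_copyAll (k : ℕ) : ∀ {ι : Type} [Fintype ι] [DecidableEq ι] (g : ι → Bool),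
    (copyAll (N := N) k g).queries = 0 := by
  induction k with
  | zero => intro ι _ _ g; rfl
  | succ k ih => intro ι _ _ g; exact ih _

theorem copies_copyAll (k : ℕ) : ∀ {ι : Type} [Fintype ι] [DecidableEq ι] (g : ι → Bool),
    (copyAll (N := N) k g).copies = k := by
  induction k with
  | zero => intro ι _ _ g; rfl
  | succ k ih => intro ι _ _ g; exact congrArg (· + 1) (ih _)

theorem reduced_whole {ι : Type} (ρ : Matrix ι ι ℂ) :
    reduced (Equiv.prodPUnit.{0, 0} ι).symm ρ = ρ := by
  ext a a'
  simp [reduced]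

theorem trace_proj_mul {ι K : Type} [Fintype ι] [DecidableEq ι] [DecidableEq K] (m : ι → K)
    (n : K) (ρ : Matrix ι ι ℂ) : (proj m n * ρ).trace = ∑ j, if m j = n then ρ j j else 0 := by
  simp [proj, Matrix.trace, Matrix.diagonal_mul]

theorem proj_or_false {ι : Type} [DecidableEq ι] (g : ι → Bool) :
    proj (fun q : ι × ι => g q.1 || g q.2) false = proj g false ⊗ₖ proj g false := by
  rw [proj, proj, Matrix.diagonal_kronecker_diagonal]
  congr 1
  funext q
  cases g q.1 <;> cases g q.2 <;> simp

/-- Copying the whole system squares the probability that no part satisfies `g`, since the two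
halves are independent. Thus `k` copies produce `2 ^ k` samples. -/
theorem outProb_copyAll (x : Input N) (k : ℕ) :
    ∀ {ι : Type} [Fintype ι] [DecidableEq ι] (g : ι → Bool) (ρ : Matrix ι ι ℂ) (q : ℝ),
      ρ.trace = 1 → (proj g false * ρ).trace = q →
      (copyAll k g).outProb x false ρ = q ^ 2 ^ k ∧
        (copyAll k g).outProb x true ρ = 1 - q ^ 2 ^ k := by
  induction k with
  | zero =>
    intro ι _ _ g ρ q hρ hq
    have hsum : (proj g true * ρ).trace + (proj g false * ρ).trace = 1 := by
      rw [← Matrix.trace_add, ← Matrix.add_mul, ← Fintype.sum_bool, sum_proj, Matrix.one_mul, hρ]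
    rw [hq] at hsum
    simp only [copyAll, Circuit.outProb, outcomeProb, pow_zero, pow_one]
    refine ⟨by rw [hq, Complex.ofReal_re], ?_⟩
    rw [eq_sub_of_add_eq hsum, Complex.sub_re, Complex.one_re, Complex.ofReal_re]
  | succ k ih =>
    intro ι _ _ g ρ q hρ hq
    simp only [copyAll, Circuit.outProb, reduced_whole]
    rw [pow_succ' 2 k, pow_mul]
    refine ih _ _ (q ^ 2) ?_ ?_
    · rw [Matrix.trace_kronecker, hρ, one_mul]
    · rw [proj_or_false, ← Matrix.mul_kronecker_mul, Matrix.trace_kronecker, hq, sq]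
      push_cast
      rfl

/-- A unit vector with real entries, different from the basis vector `j₀`, is the image of that
basis vector under a self-adjoint unitary. -/
theorem exists_reflection {ι : Type} [Fintype ι] [DecidableEq ι] (j₀ : ι) (u : ι → ℝ)
    (hu : ∑ j, u j ^ 2 = 1) (hne : u j₀ ≠ 1) :
    ∃ U ∈ Matrix.unitaryGroup ι ℂ, Uᴴ = U ∧ ∀ j, U j j₀ = u j := by
  let v : ι → ℝ := fun j => (if j = j₀ then 1 else 0) - u j
  have hvv : ∑ j, v j * v j = 2 * (1 - u j₀) := by
    have : ∀ j, v j * v j = (if j = j₀ then 1 - 2 * u j else 0) + u j ^ 2 := by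
      intro j
      by_cases h : j = j₀ <;> simp [v, h] <;> ring
    simp only [this, Finset.sum_add_distrib, hu, Finset.sum_ite_eq', Finset.mem_univ, if_true]
    ring
  have hpos : (1 - u j₀) ≠ 0 := sub_ne_zero.mpr hne.symm
  -- The Householder coefficient `2 / ‖v‖²`, by `hvv`.
  let c : ℝ := (1 - u j₀)⁻¹
  let H : Matrix ι ι ℝ := 1 - c • Matrix.vecMulVec v v
  have hHT : Hᵀ = H := by
    simp [H, Matrix.transpose_vecMulVec]
  have hHH : H * H = 1 := by
    have h₁ : Matrix.vecMulVec v v * Matrix.vecMulVec v v =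
        (2 * (1 - u j₀)) • Matrix.vecMulVec v v := by
      rw [Matrix.vecMulVec_mul_vecMulVec]
      ext i j
      simp only [dotProduct, hvv, Matrix.vecMulVec_apply, Matrix.smul_apply, smul_eq_mul,
        Pi.smul_apply]
      ring
    have h₂ : c * c * (2 * (1 - u j₀)) = 2 * c := by
      simp only [c]
      field_simp
    simp only [H]
    rw [Matrix.sub_mul, Matrix.mul_sub, Matrix.mul_sub, Matrix.one_mul, Matrix.mul_one,
      Matrix.one_mul, Matrix.smul_mul, Matrix.mul_smul, h₁, smul_smul, smul_smul, h₂, two_mul,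
      add_smul]
    abel
  have hmap : (H.map Complex.ofReal)ᴴ = H.map Complex.ofReal := by
    conv_rhs => rw [← hHT]
    ext i j
    simp
  refine ⟨H.map Complex.ofReal, ?_, hmap, fun j => ?_⟩
  · rw [Matrix.mem_unitaryGroup_iff, Matrix.star_eq_conjTranspose, hmap]
    have : (H * H).map Complex.ofReal = H.map Complex.ofReal * H.map Complex.ofReal :=
      Matrix.map_mul (f := Complex.ofRealHom)
    rw [← this, hHH, Matrix.map_one _ Complex.ofReal_zero Complex.ofReal_one]
  · have : H j j₀ = u j := by
      simp only [H, Matrix.sub_apply, Matrix.one_apply, Matrix.smul_apply, Matrix.vecMulVec_apply,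
        smul_eq_mul]
      have : c * (v j * v j₀) = v j := by
        simp only [v, c, if_true]
        field_simp
      rw [this]
      simp only [v]
      ring
    rw [Matrix.map_apply, this]

/-- The real part of the return amplitude: the mean sign of the phase oracle. -/
theorem sum_phase_sign (x : Input N) :
    ∑ j : Fin N × Bool, (if x j.1 = true ∧ j.2 = true then (-1 : ℝ) else 1) =
      2 * (N - (Finset.univ.filter fun i => x i = true).card) := by
  rw [Fintype.sum_prod_type]
  have : ∀ i : Fin N, ∑ b : Bool, (if x i = true ∧ b = true then (-1 : ℝ) else 1) =
      2 - 2 * (if x i = true then 1 else 0) := by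
    intro i
    rw [Fintype.sum_bool]
    by_cases h : x i = true <;> (simp [h]; try norm_num)
  simp only [this, Finset.sum_sub_distrib, ← Finset.mul_sum, Finset.sum_boole]
  simp
  ring

/-- Query once between two applications of the unitary `U`, copy the whole system `k` times and
output `false` if every part is found in the basis state `j₀`. -/
def searchCircuit (k : ℕ) (j₀ : Fin N × Bool) (U : Matrix.unitaryGroup (Fin N × Bool) ℂ) :
    Circuit N (Fin N × Bool) :=
  .unitary U (.query (Equiv.prodPUnit.{0, 0} _).symm
    (.unitary U (copyAll k fun j => !decide (j = j₀))))

/-- The search circuit, started in the basis state `j₀`. -/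
def searchAlgorithm (k : ℕ) (j₀ : Fin N × Bool) (U : Matrix.unitaryGroup (Fin N × Bool) ℂ) :
    Algorithm N where
  ι := Fin N × Bool
  start := j₀
  circuit := searchCircuit k j₀ U

/-- `U` sends `j₀` to the uniform vector and, being self-adjoint, back again. The amplitude of
return to `j₀` is therefore the mean oracle sign, `1 - r/N` for `r` marked positions. -/
theorem outProb_searchAlgorithm (k : ℕ) (j₀ : Fin N × Bool)
    (U : Matrix.unitaryGroup (Fin N × Bool) ℂ) (hU : U.1ᴴ = U.1)
    (hcol : ∀ j, U.1 j j₀ = ((√(2 * N))⁻¹ : ℝ)) (x : Input N) :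
    let q := ((N - (Finset.univ.filter fun i => x i = true).card : ℝ) / N) ^ 2
    (searchAlgorithm k j₀ U).outProb x false = q ^ 2 ^ k ∧
      (searchAlgorithm k j₀ U).outProb x true = 1 - q ^ 2 ^ k := by
  intro q
  have hUU := Matrix.mem_unitaryGroup_iff'.mp U.2
  let O := phaseOracle x (Equiv.prodPUnit.{0, 0} (Fin N × Bool)).symm
  let M₀ : Matrix (Fin N × Bool) Unit ℂ := Matrix.single j₀ () 1
  have hM₀ : Matrix.single j₀ j₀ 1 = M₀ * M₀ᴴ := by simp [M₀]
  let M := U.1 * (O * (U.1 * M₀))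
  have hamp : M j₀ () = (((N - (Finset.univ.filter fun i => x i = true).card : ℝ) / N : ℝ) : ℂ) := by
    have hrow : ∀ j, U.1 j₀ j = ((√(2 * N))⁻¹ : ℝ) := by
      intro j
      rw [← hU, Matrix.conjTranspose_apply, hcol, RCLike.star_def, Complex.conj_ofReal]
    have hcol' : ∀ j, (U.1 * M₀) j () = ((√(2 * N))⁻¹ : ℝ) := by
      intro j
      simp [M₀, hcol, Matrix.mul_apply, Matrix.single_apply]
    have hterm : ∀ j : Fin N × Bool, U.1 j₀ j * (O * (U.1 * M₀)) j () =
        (((2 * N : ℝ)⁻¹ * (if x j.1 = true ∧ j.2 = true then (-1 : ℝ) else 1) : ℝ) : ℂ) := by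
      intro j
      simp only [O, phaseOracle, Matrix.diagonal_mul, hrow, hcol']
      have h : ((√(2 * N : ℝ))⁻¹ : ℝ) * (√(2 * N : ℝ))⁻¹ = (2 * N : ℝ)⁻¹ := by
        rw [← mul_inv, Real.mul_self_sqrt (by positivity)]
      rw [← h]
      by_cases hj : x j.1 = true ∧ j.2 = true <;> simp [hj]
    simp only [M]
    rw [Matrix.mul_apply, Finset.sum_congr rfl fun j _ => hterm j, ← Complex.ofReal_sum,
      ← Finset.mul_sum, sum_phase_sign]
    congr 1
    rw [mul_inv]
    ring
  have hρ : (M * Mᴴ).trace = 1 := by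
    have hO : Oᴴ * O = 1 := phaseOracle_isometry x _
    rw [Matrix.trace_mul_comm, ← overlap, overlap_mul_of_isometry _ hUU,
      overlap_mul_of_isometry _ hO, overlap_mul_of_isometry _ hUU]
    simp [overlap, M₀]
  have hq : (proj (fun j => !decide (j = j₀)) false * (M * Mᴴ)).trace = (q : ℂ) := by
    rw [trace_proj_mul]
    simp only [Bool.not_eq_false', decide_eq_true_eq, Finset.sum_ite_eq', Finset.mem_univ, if_true]
    rw [Matrix.mul_apply, Fintype.sum_unique, Matrix.conjTranspose_apply, Unique.default_eq, hamp,
      RCLike.star_def, Complex.conj_ofReal, ← Complex.ofReal_mul, ← sq]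
  have hrun : ∀ b, (searchAlgorithm k j₀ U).outProb x b =
      (copyAll k fun j => !decide (j = j₀)).outProb x b (M * Mᴴ) := by
    intro b
    change (searchCircuit k j₀ U).outProb x b (Matrix.single j₀ j₀ 1) = _
    simp only [searchCircuit, Circuit.outProb, hM₀, conj_purified]
    rfl
  rw [hrun, hrun]
  exact outProb_copyAll x k _ _ q hρ hq

/-- Without marked positions the state returns to `j₀` with certainty, so the error is one-sided.
With some, a sample misses with probability at most `exp (-1/N)`, so about `N log (1/ε)` samples
suffice, obtained from logarithmically many copies. -/
theorem exists_searchAlgorithm {ε : ℝ} (hε : 0 < ε) : ∃ C : ℝ, ∀ N : ℕ, 2 ≤ N →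
    ∃ A : Algorithm N, A.Solves (search N) ε ∧ A.queries = 1 ∧
      (A.copies : ℝ) ≤ C * Real.log N := by
  obtain ⟨t, ht⟩ : ∃ t : ℕ, -Real.log ε ≤ 2 ^ t := by
    obtain ⟨t, ht⟩ := pow_unbounded_of_one_lt (-Real.log ε) (one_lt_two (α := ℝ))
    exact ⟨t, ht.le⟩
  have hlog2 : 0 < Real.log 2 := Real.log_pos one_lt_two
  -- The number of copies is `Nat.log 2 N + 1 + t`; since `log N ≥ log 2`, the constant `1 + t` is
  -- absorbed into the logarithm.
  refine ⟨(2 + t) / Real.log 2, fun N hN => ?_⟩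
  have hN0 : (0 : ℝ) < N := by exact_mod_cast (by omega : 0 < N)
  have hN2 : (2 : ℝ) ≤ N := by exact_mod_cast hN
  let j₀ : Fin N × Bool := (⟨0, by omega⟩, false)
  obtain ⟨U, hUmem, hU, hcol⟩ := exists_reflection j₀ (fun _ => (√(2 * N : ℝ))⁻¹)
    (by
      rw [Finset.sum_const, Finset.card_univ, Fintype.card_prod, Fintype.card_fin,
        Fintype.card_bool, nsmul_eq_mul, inv_pow, Real.sq_sqrt (by positivity)]
      push_cast
      field_simp)
    (by
      rw [Ne, inv_eq_one, Real.sqrt_eq_one]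
      linarith)
  -- Chosen so that `2 ^ k ≥ N * 2 ^ t`, where `2 ^ t ≥ log (1/ε)`.
  let k := Nat.log 2 N + 1 + t
  refine ⟨searchAlgorithm k j₀ ⟨U, hUmem⟩, fun x => ?_, ?_, ?_⟩
  · obtain ⟨h₀, h₁⟩ := outProb_searchAlgorithm k j₀ ⟨U, hUmem⟩ hU hcol x
    set r := (Finset.univ.filter fun i => x i = true).card with hr
    by_cases hx : ∃ i, x i = true
    · have hs : search N x = true := decide_eq_true hx
      rw [hs, h₁]
      have hr1 : 1 ≤ r := by
        obtain ⟨i, hi⟩ := hx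
        exact Finset.card_pos.mpr ⟨i, Finset.mem_filter.mpr ⟨Finset.mem_univ _, hi⟩⟩
      have hrN : r ≤ N := (Finset.card_le_univ _).trans (Fintype.card_fin N).le
      have hr1' : (1 : ℝ) ≤ r := by exact_mod_cast hr1
      have hrN' : (r : ℝ) ≤ N := by exact_mod_cast hrN
      have hb₀ : 0 ≤ (N - r : ℝ) / N := div_nonneg (by linarith) hN0.le
      have hb₁ : (N - r : ℝ) / N ≤ 1 - 1 / N := by
        rw [sub_div, div_self hN0.ne']
        gcongr
      have hb₂ : (N - r : ℝ) / N ≤ Real.exp (-(1 / N)) :=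
        hb₁.trans (Real.one_sub_le_exp_neg _)
      have hb₃ : ((N - r : ℝ) / N) ^ 2 ≤ Real.exp (-(1 / N)) := by
        rw [sq]
        refine (mul_le_of_le_one_right hb₀ ?_).trans hb₂
        rw [div_le_one hN0]
        linarith
      have hk : (N : ℝ) * 2 ^ t ≤ 2 ^ k := by
        have : N ≤ 2 ^ (Nat.log 2 N + 1) := (Nat.lt_pow_succ_log_self one_lt_two N).le
        simp only [k]
        rw [pow_add]
        gcongr
        exact_mod_cast this
      have hfinal : (((N - r : ℝ) / N) ^ 2) ^ 2 ^ k ≤ ε := by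
        calc _ ≤ Real.exp (-(1 / N)) ^ 2 ^ k := pow_le_pow_left₀ (sq_nonneg _) hb₃ _
          _ = Real.exp (-(2 ^ k / N)) := by
            rw [← Real.exp_nat_mul]
            congr 1
            push_cast
            ring
          _ ≤ Real.exp (Real.log ε) := by
            refine Real.exp_le_exp.mpr ?_
            have : (2 : ℝ) ^ t ≤ 2 ^ k / N := by
              rw [le_div_iff₀ hN0]
              linarith
            linarith
          _ = ε := Real.exp_log hε
      linarith
    · have hs : search N x = false := decide_eq_false hx
      have hr0 : r = 0 := by
        rw [hr, Finset.card_eq_zero, Finset.filter_eq_empty_iff]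
        exact fun i _ hi => hx ⟨i, hi⟩
      rw [hs, h₀, hr0, Nat.cast_zero, sub_zero, div_self hN0.ne', one_pow, one_pow]
      linarith
  · change (searchCircuit k j₀ ⟨U, hUmem⟩).queries = 1
    simp only [searchCircuit, Circuit.queries, queries_copyAll]
  · have hcop : (searchAlgorithm k j₀ ⟨U, hUmem⟩).copies = k := by
      change (searchCircuit k j₀ ⟨U, hUmem⟩).copies = k
      simp only [searchCircuit, Circuit.copies, copies_copyAll]
    rw [hcop]
    have hlogN : Real.log 2 ≤ Real.log N := Real.log_le_log two_pos hN2
    have h₁ : (Nat.log 2 N : ℝ) * Real.log 2 ≤ Real.log N := by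
      rw [← Real.log_pow]
      refine Real.log_le_log (by positivity) ?_
      exact_mod_cast Nat.pow_log_le_self 2 (by omega : N ≠ 0)
    have h₂ : (1 + t : ℝ) * Real.log 2 ≤ (1 + t) * Real.log N := by gcongr
    rw [div_mul_eq_mul_div, le_div_iff₀ hlog2]
    simp only [k]
    push_cast
    linarith

end SearchAlgorithm

end CBQP

/-! ### The main theorem; the lower bounds on `Q · 2^P` share the constant `(1 - 2ε)² / 16`. -/

theorem mainTheorem4 (ε : ℝ) (hε₀ : 0 ≤ ε) (hε : ε < 1 / 2) :
    -- the weighted bound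
    (∃ c : ℝ, 0 < c ∧ ∀ (N : ℕ) (f : CBQP.Input N → Bool) (S : CBQP.WeightScheme f),
      S.R.Nonempty → 0 < S.vmax ∧ ∀ A : CBQP.Algorithm N, A.Solves f ε →
        c * (1 / S.vmax) ≤ (A.queries : ℝ) * 2 ^ A.copies) ∧
    -- the unweighted bound
    (∃ c : ℝ, 0 < c ∧ ∀ (N : ℕ) (f : CBQP.Input N → Bool) (X Y : Finset (CBQP.Input N))
      (R : Finset (CBQP.Input N × CBQP.Input N)), (∀ x ∈ X, f x = false) →
      (∀ y ∈ Y, f y = true) → R ⊆ X ×ˢ Y → R.Nonempty →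
      0 < CBQP.maxDiffX X R * CBQP.maxDiffY Y R ∧ ∀ A : CBQP.Algorithm N, A.Solves f ε →
        c * Real.sqrt ((CBQP.minDegX X R * CBQP.minDegY Y R : ℝ) /
          (CBQP.maxDiffX X R * CBQP.maxDiffY Y R : ℝ)) ≤ (A.queries : ℝ) * 2 ^ A.copies) ∧
    -- search
    (∃ c : ℝ, 0 < c ∧ ∀ (N : ℕ) (A : CBQP.Algorithm N), A.Solves (CBQP.search N) ε →
      c * Real.sqrt N ≤ (A.queries : ℝ) * 2 ^ A.copies) ∧
    -- a one-query search algorithm needs a logarithmic number of copies,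
    (∃ c : ℝ, 0 < c ∧ ∃ N₀ : ℕ, ∀ N : ℕ, N₀ ≤ N → ∀ A : CBQP.Algorithm N,
      A.Solves (CBQP.search N) ε → A.queries ≤ 1 → c * Real.log N ≤ A.copies) ∧
    -- and for every positive error a logarithmic number of copies suffices
    (0 < ε → ∃ C : ℝ, ∀ N : ℕ, 2 ≤ N → ∃ A : CBQP.Algorithm N,
      A.Solves (CBQP.search N) ε ∧ A.queries = 1 ∧ (A.copies : ℝ) ≤ C * Real.log N) := by
  have hc : 0 < (1 - 2 * ε) ^ 2 / 16 := by
    have : 0 < 1 - 2 * ε := by linarith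
    positivity
  refine ⟨⟨_, hc, fun N f S hR => ⟨S.vmax_pos hR, fun A hA =>
    S.queries_mul_two_pow_copies_ge hR hε A hA⟩⟩, ⟨_, hc, fun N f X Y R hX hY hR hne => ?_⟩,
    ⟨_, hc, fun N A hA => CBQP.search_bound hε A hA⟩, ⟨1 / 4, by norm_num, ?_⟩,
    fun hpos => CBQP.exists_searchAlgorithm hpos⟩
  · obtain ⟨hl, hl'⟩ := CBQP.maxDiff_pos hX hY hR hne
    exact ⟨Nat.mul_pos hl hl', fun A hA => CBQP.unweighted_bound hX hY hR hne hε A hA⟩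
  · obtain ⟨N₀, h⟩ := CBQP.copies_ge_of_bound hc
    exact ⟨N₀, fun N hN A hA hQ => h N hN _ _ (CBQP.search_bound hε A hA) hQ⟩
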